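/- Fix a dimension $d$. An input consists of $n$ points $p_1,\dots,p_n\in\mathbb{R}^d$ (not necessarily distinct), each point $p_i$ with a lifespan $I_i=[I_i^-,I_i^+]$, $I_i^-\le I_i^+$, and a real parameter $\tau>1$. Let $G$ be the unit-disk graph on $\{1,\dots,n\}$ in which $i\ne j$ are adjacent if and only if $\|p_i-p_j\|_\infty\le 1$. A $\tau$-durable triangle is a set $\{i,j,k\}$ of three pairwise adjacent vertices of $G$ such that the interval $I_i\cap I_j\cap I_k$ has length at least $\tau$; let $K_\tau$ be the number of $\tau$-durable triangles. Theorem. For every $d$ there are a real RAM program and a constant $C$ (both depending only on $d$) such that, for every $n$, every input of $n$ points with lifespans, and every $\tau>1$, the program halts and outputs a list that contains every $\tau$-durable triangle exactly once (as a triple of indices) and nothing else, and for $n\ge 2$ it makes at most $$C\,\bigl(n\log^{2d+2}n+K_\tau\bigr)$$ steps, i.e. its running time is $O(n\log^{2d+2}n+K_\tau)$. Here the real RAM is the usual unit-cost model: a fixed finite program with branching and (recursive) procedures works on words (natural numbers, with addition, truncated subtraction and comparison), real numbers (with $+,-,\times,\div$ and comparison, but without rounding to integers), pointers to two-cell records,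 and a random access memory addressed by words; each primitive operation is one step. The input is given as $\tau$ together with the linked list of the points, each with its two endpoints and its list of coordinates. -/

import Mathlib

open MeasureTheory

/-! ## A real RAM with unit-cost instructions

Programs are finite tables of first-order, possibly recursive procedures. They work on words
(natural numbers), real numbers and immutable pairs (pointers to two-cell records), and have a
random access memory. Each primitive is a constant number of steps of a real RAM (no rounding of
reals to integers, no multiplication of words), and each real RAM instruction is a primitive. -/

namespace RealRAM

/-- The contents of one memory cell or local variable: a word, a real number, or a pointer to an
immutable record with two cells. -/
inductive Val : Type
  | nat (k : ℕ)
  | real (x : ℝ)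
  | pair (a b : Val)

/-- Unary primitives. -/
inductive Op1 : Type
  /-- first cell of a record -/
  | fst
  /-- second cell of a record -/
  | snd
  /-- test whether the argument is a record -/
  | isPair
  /-- conversion of a word into a real number -/
  | toReal

/-- Binary primitives. Both arguments of an arithmetic operation or a comparison are words, or both
are real numbers. -/
inductive Op2 : Type
  /-- allocation of a record -/
  | mkPair
  /-- sum -/
  | add
  /-- difference, truncated at zero on words -/
  | sub
  /-- product of real numbers -/
  | mul
  /-- quotient of real numbers, undefined if the divisor is zero -/
  | div
  /-- comparison `<` -/
  | lt
  /-- comparison `≤` -/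
  | le

open Classical in
/-- Truth values are the words `1` and `0`. -/
noncomputable def Val.ofProp (p : Prop) : Val := if p then Val.nat 1 else Val.nat 0

/-- The value of a unary primitive, `none` on an argument of the wrong kind. -/
noncomputable def Op1.run : Op1 → Val → Option Val
  | .fst, .pair a _ => some a
  | .snd, .pair _ b => some b
  | .isPair, .pair _ _ => some (.nat 1)
  | .isPair, _ => some (.nat 0)
  | .toReal, .nat k => some (.real (k : ℝ))
  | _, _ => none

open Classical in
/-- The value of a binary primitive, `none` on arguments of the wrong kind. -/
noncomputable def Op2.run : Op2 → Val → Val → Option Val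
  | .mkPair, a, b => some (.pair a b)
  | .add, .nat k, .nat l => some (.nat (k + l))
  | .add, .real x, .real y => some (.real (x + y))
  | .sub, .nat k, .nat l => some (.nat (k - l))
  | .sub, .real x, .real y => some (.real (x - y))
  | .mul, .real x, .real y => some (.real (x * y))
  | .div, .real x, .real y => if y = 0 then none else some (.real (x / y))
  | .lt, .nat k, .nat l => some (Val.ofProp (k < l))
  | .lt, .real x, .real y => some (Val.ofProp (x < y))
  | .le, .nat k, .nat l => some (Val.ofProp (k ≤ l))
  | .le, .real x, .real y => some (Val.ofProp (x ≤ y))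
  | _, _, _ => none

/-- Program code. Local variables are numbered from the most recently bound one. -/
inductive Code : Type
  /-- a local variable -/
  | var (i : ℕ)
  /-- a constant word -/
  | const (k : ℕ)
  /-- a unary primitive -/
  | op1 (o : Op1) (c : Code)
  /-- a binary primitive, arguments evaluated from left to right -/
  | op2 (o : Op2) (c₁ c₂ : Code)
  /-- branching on a word: first branch if it is not zero, second branch if it is zero -/
  | ite (c c₁ c₂ : Code)
  /-- bind a new local variable to the value of `c` in `body` -/
  | bind (c body : Code)
  /-- call procedure number `f` with the value of `c` as its only local variable -/
  | call (f : ℕ) (c : Code)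
  /-- read the memory cell whose address is the value of `c` -/
  | load (c : Code)
  /-- write the value of `c` into the memory cell whose address is the value of `addr` -/
  | store (addr c : Code)

/-- A program is a finite table of procedures; procedure `0` is the main one. -/
abbrev Program : Type := List Code

/-- The random access memory. -/
abbrev Mem : Type := ℕ → Val

/-- `Eval P env m c v m' t`: with procedures `P`, local variables `env` and memory `m`, the code `c`
terminates with value `v` and memory `m'` after `t` steps, every executed primitive, variable access,
constant, branching, binding, call, read or write being one step. -/
inductive Eval (P : Program) : List Val → Mem → Code → Val → Mem → ℕ → Prop
  | var {env : List Val} {m : Mem} {i : ℕ} {v : Val} (h : env[i]? = some v) :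
      Eval P env m (.var i) v m 1
  | const {env : List Val} {m : Mem} {k : ℕ} :
      Eval P env m (.const k) (.nat k) m 1
  | op1 {env : List Val} {m m₁ : Mem} {o : Op1} {c : Code} {a v : Val} {t : ℕ}
      (h : Eval P env m c a m₁ t) (hv : o.run a = some v) :
      Eval P env m (.op1 o c) v m₁ (t + 1)
  | op2 {env : List Val} {m m₁ m₂ : Mem} {o : Op2} {c₁ c₂ : Code} {a b v : Val} {t₁ t₂ : ℕ}
      (h₁ : Eval P env m c₁ a m₁ t₁) (h₂ : Eval P env m₁ c₂ b m₂ t₂) (hv : o.run a b = some v) :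
      Eval P env m (.op2 o c₁ c₂) v m₂ (t₁ + t₂ + 1)
  | ite_true {env : List Val} {m m₁ m₂ : Mem} {c c₁ c₂ : Code} {k : ℕ} {v : Val} {t t₁ : ℕ}
      (h : Eval P env m c (.nat k) m₁ t) (hk : k ≠ 0) (h₁ : Eval P env m₁ c₁ v m₂ t₁) :
      Eval P env m (.ite c c₁ c₂) v m₂ (t + t₁ + 1)
  | ite_false {env : List Val} {m m₁ m₂ : Mem} {c c₁ c₂ : Code} {v : Val} {t t₂ : ℕ}
      (h : Eval P env m c (.nat 0) m₁ t) (h₂ : Eval P env m₁ c₂ v m₂ t₂) :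
      Eval P env m (.ite c c₁ c₂) v m₂ (t + t₂ + 1)
  | bind {env : List Val} {m m₁ m₂ : Mem} {c body : Code} {a v : Val} {t₁ t₂ : ℕ}
      (h₁ : Eval P env m c a m₁ t₁) (h₂ : Eval P (a :: env) m₁ body v m₂ t₂) :
      Eval P env m (.bind c body) v m₂ (t₁ + t₂ + 1)
  | call {env : List Val} {m m₁ m₂ : Mem} {f : ℕ} {c body : Code} {a v : Val} {t₁ t₂ : ℕ}
      (h₁ : Eval P env m c a m₁ t₁) (hf : P[f]? = some body) (h₂ : Eval P [a] m₁ body v m₂ t₂) :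
      Eval P env m (.call f c) v m₂ (t₁ + t₂ + 1)
  | load {env : List Val} {m m₁ : Mem} {c : Code} {k t : ℕ}
      (h : Eval P env m c (.nat k) m₁ t) :
      Eval P env m (.load c) (m₁ k) m₁ (t + 1)
  | store {env : List Val} {m m₁ m₂ : Mem} {addr c : Code} {k : ℕ} {v : Val} {t₁ t₂ : ℕ}
      (h₁ : Eval P env m addr (.nat k) m₁ t₁) (h₂ : Eval P env m₁ c v m₂ t₂) :
      Eval P env m (.store addr c) v (Function.update m₂ k v) (t₁ + t₂ + 1)

/-- The program `P`, started on `input` with a memory full of zeros, halts with the value `output`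
after exactly `t` steps. -/
def Program.Runs (P : Program) (input output : Val) (t : ℕ) : Prop :=
  ∃ (main : Code) (m : Mem), P[0]? = some main ∧
    Eval P [input] (fun _ => Val.nat 0) main output m t

/-- Linked lists: the empty list is the word `0`, a nonempty list is a record with head and tail. -/
def Val.ofList : List Val → Val
  | [] => .nat 0
  | a :: l => .pair a (Val.ofList l)

end RealRAM

/-! ## Points with lifespans and durable triangles -/

/-- `n` points of `ℝ^d`, each with a lifespan `[lo i, hi i]`. The type `Fin d → ℝ` carries the
distance of the `L∞` norm. -/
structure TemporalPoints (d n : ℕ) : Type where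
  pos : Fin n → Fin d → ℝ
  lo : Fin n → ℝ
  hi : Fin n → ℝ
  lo_le_hi : ∀ i, lo i ≤ hi i

namespace TemporalPoints

variable {d n : ℕ}

/-- The lifespan of a point. -/
def lifespan (S : TemporalPoints d n) (i : Fin n) : Set ℝ := Set.Icc (S.lo i) (S.hi i)

/-- The unit-disk graph in the `L∞` norm. -/
def unitDiskGraph (S : TemporalPoints d n) : SimpleGraph (Fin n) where
  Adj i j := i ≠ j ∧ dist (S.pos i) (S.pos j) ≤ 1
  symm := ⟨fun _ _ h => ⟨h.1.symm, (dist_comm _ _).trans_le h.2⟩⟩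
  loopless := ⟨fun _ h => h.1 rfl⟩

/-- The `τ`-durable triangles: triangles of the unit-disk graph such that the lifespans of the three
vertices have an intersection of length at least `τ`. -/
def durableTriangles (S : TemporalPoints d n) (τ : ℝ) : Set (Finset (Fin n)) :=
  {s | S.unitDiskGraph.IsNClique 3 s ∧ ENNReal.ofReal τ ≤ volume (⋂ i ∈ s, S.lifespan i)}

open RealRAM

/-- A point as a record: left endpoint, right endpoint, list of the `d` coordinates. -/
def encodePoint (S : TemporalPoints d n) (i : Fin n) : Val :=
  .pair (.real (S.lo i)) (.pair (.real (S.hi i))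
    (Val.ofList (List.ofFn fun k => Val.real (S.pos i k))))

/-- The input: the threshold `τ` and the list of the points. -/
def encodeInput (S : TemporalPoints d n) (τ : ℝ) : Val :=
  .pair (.real τ) (Val.ofList (List.ofFn S.encodePoint))

end TemporalPoints

/-- A list of triples of indices, as a value of the machine. -/
def encodeTriples {n : ℕ} (L : List (Fin n × Fin n × Fin n)) : RealRAM.Val :=
  RealRAM.Val.ofList (L.map fun p => .pair (.nat p.1) (.pair (.nat p.2.1) (.nat p.2.2)))

/-- `output` lists every member of the family `T` of vertex sets exactly once, each as a triple of
indices of its vertices, and lists nothing else. -/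
def ReportsOnce {n : ℕ} (output : RealRAM.Val) (T : Set (Finset (Fin n))) : Prop :=
  ∃ L : List (Fin n × Fin n × Fin n), output = encodeTriples L ∧
    (L.map fun p => ({p.1, p.2.1, p.2.2} : Finset (Fin n))).Nodup ∧
    ∀ s : Finset (Fin n), s ∈ (L.map fun p => ({p.1, p.2.1, p.2.2} : Finset (Fin n))) ↔ s ∈ T

/-!
Let `(lo p, p)`, ordered lexicographically, be the starting time of a vertex `p`. Every `τ`-durable
triangle has a unique last vertex `p`, and its other vertices belong to the set `R p` of the points
`q` near `p` with `lo q ≤ lo p` and `lo p + τ ≤ hi q`. The program computes `R p` for every `p`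
whose own lifespan has length at least `τ`, removes the points that do not start before `p`, and
tests all remaining pairs for nearness.

Testing all pairs is affordable in the `L∞` norm: the unit ball around `p` consists of `2 ^ d`
orthants of diameter one, so by the pigeonhole principle a fixed fraction of the pairs in `R p`,
up to an additive constant, forms durable triangles with `p` (`sq_card_covers_le`). Here triangles
are counted at all of their vertices and not just at the last one, so that ties among the starting
times do no harm; summed over `p`, every triangle is counted three times at most. Hence the sizes
of the `R p` satisfy `∑ p, (|R p| + 1) ^ 2 = O(n + K)` (`sum_sq_length_le`).

The set `R p` is described by upper bounds on the `2 d + 2` keys `lo q, -hi q, x₁, -x₁, …, x_d, -x_d`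
of `q`, so that it can be found by a range tree with `2 d + 2` levels. A node of such a tree divides
the items, sorted by their first keys, in the middle, and keeps the middle item `x` and the items
before it in a range tree for the remaining keys. A query whose first entry is not below the first
key of `x` queries that tree and goes on to the right, all other queries go on to the left.
Each level costs one logarithmic factor, for the construction as well as for the queries
(`buildable`). No separate tree type is needed: a machine value is a range tree if the query
procedure answers all queries on it correctly and in time (`IsRangeTree`).

The program never touches the random access memory. Its procedures are therefore specified by
`Calls`, which bounds the number of steps of a call from above, and such specifications are derived
by computing weakest preconditions (`wp`).
-/

set_option linter.unusedSimpArgs false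

namespace RealRAM

/-! ### Weakest preconditions for programs without memory accesses -/

/-- `Calls P f a v T`: procedure `f` of `P`, applied to `a`, returns `v` after at most `T` steps,
whatever the memory contains, and does not change the memory. -/
def Calls (P : Program) (f : ℕ) (a v : Val) (T : ℕ) : Prop :=
  ∃ body t, P[f]? = some body ∧ t ≤ T ∧ ∀ m, Eval P [a] m body v m t

theorem Calls.mono {P : Program} {f : ℕ} {a v : Val} {T T' : ℕ} (h : Calls P f a v T)
    (hT : T ≤ T') : Calls P f a v T' := by
  obtain ⟨body, t, hb, ht, he⟩ := h
  exact ⟨body, t, hb, ht.trans hT, he⟩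

/-- A predicate transformer for code that neither reads nor writes the memory: `wp P env c Q`
implies that `c` terminates with a value `v` for which `Q v T` holds for some upper bound `T` on the
number of steps. Procedure calls are resolved by `Calls`. -/
def wp (P : Program) : List Val → Code → (Val → ℕ → Prop) → Prop
  | env, .var i, Q => ∃ v, env[i]? = some v ∧ Q v 1
  | _, .const k, Q => Q (.nat k) 1
  | env, .op1 o c, Q => wp P env c fun a t => ∃ v, o.run a = some v ∧ Q v (t + 1)
  | env, .op2 o c₁ c₂, Q => wp P env c₁ fun a t₁ => wp P env c₂ fun b t₂ =>
      ∃ v, o.run a b = some v ∧ Q v (t₁ + t₂ + 1)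
  | env, .ite c c₁ c₂, Q => wp P env c fun a t => ∃ k, a = .nat k ∧
      if k = 0 then wp P env c₂ fun v t' => Q v (t + t' + 1)
      else wp P env c₁ fun v t' => Q v (t + t' + 1)
  | env, .bind c body, Q => wp P env c fun a t₁ => wp P (a :: env) body fun v t₂ =>
      Q v (t₁ + t₂ + 1)
  | env, .call f c, Q => wp P env c fun a t => ∃ v T, Calls P f a v T ∧ Q v (t + T + 1)
  | _, .load _, _ => False
  | _, .store _ _, _ => False

theorem wp_sound {P : Program} {c : Code} : ∀ {env : List Val} {Q : Val → ℕ → Prop},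
    wp P env c Q → ∃ v t T, t ≤ T ∧ Q v T ∧ ∀ m, Eval P env m c v m t := by
  induction c with
  | var i =>
    rintro env Q ⟨v, hv, hQ⟩
    exact ⟨v, 1, 1, le_rfl, hQ, fun m => .var hv⟩
  | const k =>
    intro env Q hQ
    exact ⟨_, 1, 1, le_rfl, hQ, fun m => .const⟩
  | op1 o c ih =>
    intro env Q h
    obtain ⟨a, t, T, ht, ⟨v, hv, hQ⟩, he⟩ := ih h
    exact ⟨v, t + 1, T + 1, by omega, hQ, fun m => .op1 (he m) hv⟩
  | op2 o c₁ c₂ ih₁ ih₂ =>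
    intro env Q h
    obtain ⟨a, t, T, ht, h', he⟩ := ih₁ h
    obtain ⟨b, t', T', ht', ⟨v, hv, hQ⟩, he'⟩ := ih₂ h'
    exact ⟨v, t + t' + 1, T + T' + 1, by omega, hQ, fun m => .op2 (he m) (he' m) hv⟩
  | ite c c₁ c₂ ih ih₁ ih₂ =>
    intro env Q h
    obtain ⟨a, t, T, ht, ⟨k, rfl, h'⟩, he⟩ := ih h
    by_cases hk : k = 0
    · subst hk
      rw [if_pos rfl] at h'
      obtain ⟨v, t', T', ht', hQ, he'⟩ := ih₂ h'
      exact ⟨v, t + t' + 1, T + T' + 1, by omega, hQ, fun m => .ite_false (he m) (he' m)⟩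
    · rw [if_neg hk] at h'
      obtain ⟨v, t', T', ht', hQ, he'⟩ := ih₁ h'
      exact ⟨v, t + t' + 1, T + T' + 1, by omega, hQ, fun m => .ite_true (he m) hk (he' m)⟩
  | bind c body ih₁ ih₂ =>
    intro env Q h
    obtain ⟨a, t, T, ht, h', he⟩ := ih₁ h
    obtain ⟨v, t', T', ht', hQ, he'⟩ := ih₂ h'
    exact ⟨v, t + t' + 1, T + T' + 1, by omega, hQ, fun m => .bind (he m) (he' m)⟩
  | call f c ih =>
    intro env Q h
    obtain ⟨a, t, T, ht, ⟨v, T', ⟨body, t', hb, ht', he'⟩, hQ⟩, he⟩ := ih h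
    exact ⟨v, t + t' + 1, T + T' + 1, by omega, hQ, fun m => .call (he m) hb (he' m)⟩
  | load c _ => intro env Q h; exact h.elim
  | store a c _ _ => intro env Q h; exact h.elim

theorem Calls.of_wp {P : Program} {f : ℕ} {a v : Val} {T : ℕ} (body : Code)
    (hf : P[f]? = some body) (h : wp P [a] body fun w t => w = v ∧ t ≤ T) : Calls P f a v T := by
  obtain ⟨w, t, T', ht, ⟨rfl, hT⟩, he⟩ := wp_sound h
  exact ⟨body, t, hf, ht.trans hT, he⟩

/-! ### The program -/

namespace Code

/-! An item is a record of a payload and a list of real keys; a point with its index is a record of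
the index and the point as in the input. Triples and longer tuples are nested to the right. -/

/-- The most recently bound local variable; on entry to a procedure, its argument. -/
abbrev x₀ : Code := var 0
/-- The second most recently bound local variable. -/
abbrev x₁ : Code := var 1
abbrev fst (c : Code) : Code := op1 .fst c
abbrev snd (c : Code) : Code := op1 .snd c
abbrev isPair (c : Code) : Code := op1 .isPair c
abbrev mk (c₁ c₂ : Code) : Code := op2 .mkPair c₁ c₂
abbrev le (c₁ c₂ : Code) : Code := op2 .le c₁ c₂
abbrev lt (c₁ c₂ : Code) : Code := op2 .lt c₁ c₂
abbrev add (c₁ c₂ : Code) : Code := op2 .add c₁ c₂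
abbrev sub (c₁ c₂ : Code) : Code := op2 .sub c₁ c₂
/-- The real number `0`. -/
abbrev zeroR : Code := op1 .toReal (const 0)
/-- The real number `1`. -/
abbrev oneR : Code := op1 .toReal (const 1)

/-- `(l, l')` is mapped to the concatenation of the list of the first components of `l` with `l'`. -/
def appendFst : Code :=
  ite (isPair (fst x₀))
    (mk (fst (fst (fst x₀))) (call 1 (mk (snd (fst x₀)) (snd x₀))))
    (snd x₀)

/-- `(l, f)` is mapped to `l`, cut in two parts after half as many entries as `f` has. -/
def halve : Code :=
  ite (isPair (snd x₀))
    (ite (isPair (snd (snd x₀)))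
      (bind (call 2 (mk (snd (fst x₀)) (snd (snd (snd x₀)))))
        (mk (mk (fst (fst x₁)) (fst x₀)) (snd x₀)))
      (mk (const 0) (fst x₀)))
    (mk (const 0) (fst x₀))

/-- Merges two lists of items sorted by their first keys. -/
def merge : Code :=
  ite (isPair (fst x₀))
    (ite (isPair (snd x₀))
      (ite (le (fst (snd (fst (fst x₀)))) (fst (snd (fst (snd x₀)))))
        (mk (fst (fst x₀)) (call 3 (mk (snd (fst x₀)) (snd x₀))))
        (mk (fst (snd x₀)) (call 3 (mk (fst x₀) (snd (snd x₀))))))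
      (fst x₀))
    (snd x₀)

/-- Sorts a list of items by their first keys. -/
def sort : Code :=
  ite (isPair x₀)
    (ite (isPair (snd x₀))
      (bind (call 2 (mk x₀ x₀))
        (call 3 (mk (call 4 (fst x₀)) (call 4 (snd x₀)))))
      x₀)
    x₀

/-- Removes the first key of every item of a list. -/
def tails : Code :=
  ite (isPair x₀)
    (mk (mk (fst (fst x₀)) (snd (snd (fst x₀)))) (call 5 (snd x₀)))
    (const 0)

/-- `(D, l)` is mapped to the range tree of the list `l` of items with `D` keys each. -/
def build : Code :=
  ite (fst x₀)
    (call 7 (mk (sub (fst x₀) (const 1)) (call 4 (snd x₀))))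
    (snd x₀)

/-- `(D, l)` is mapped to the range tree of the list `l` of items with `D + 1` keys each, sorted by
their first keys. -/
def tree : Code :=
  ite (isPair (snd x₀))
    (bind (call 2 (mk (snd x₀) (snd x₀)))
      (mk (fst (snd (fst (snd x₀))))
        (mk (call 6 (mk (fst x₁) (call 5 (mk (fst (snd x₀)) (fst x₀)))))
          (mk (call 7 (mk (fst x₁) (fst x₀)))
            (call 7 (mk (fst x₁) (snd (snd x₀))))))))
    (const 0)

/-- `(v, (ys, l))` is mapped to the list of the items of the range tree `v` whose keys are at most
the entries of `ys`, followed by `l`. -/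
def query : Code :=
  ite (isPair (fst (snd x₀)))
    (ite (isPair (fst x₀))
      (ite (le (fst (fst x₀)) (fst (fst (snd x₀))))
        (call 8 (mk (snd (snd (snd (fst x₀)))) (mk (fst (snd x₀))
          (call 8 (mk (fst (snd (fst x₀))) (mk (snd (fst (snd x₀))) (snd (snd x₀))))))))
        (call 8 (mk (fst (snd (snd (fst x₀)))) (snd x₀))))
      (snd (snd x₀)))
    (call 1 (mk (fst x₀) (snd (snd x₀))))

/-- The keys `x, -x` for the coordinates `x` of a point. -/
def coordKeys : Code :=
  ite (isPair x₀)
    (mk (fst x₀) (mk (sub zeroR (fst x₀)) (call 9 (snd x₀))))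
    (const 0)

/-- The upper bounds `x + 1, 1 - x` for the keys of the points near a point. -/
def coordBounds : Code :=
  ite (isPair x₀)
    (mk (add (fst x₀) oneR) (mk (sub oneR (fst x₀)) (call 10 (snd x₀))))
    (const 0)

/-- `(l, k)` is mapped to the list of the points in `l` as items, with the indices `k, k + 1, …`. -/
def number : Code :=
  ite (isPair (fst x₀))
    (mk
      (mk (mk (snd x₀) (fst (fst x₀)))
        (mk (fst (fst (fst x₀)))
          (mk (sub zeroR (fst (snd (fst (fst x₀)))))
            (call 9 (snd (snd (fst (fst x₀))))))))
      (call 11 (mk (snd (fst x₀)) (add (snd x₀) (const 1)))))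
    (const 0)

/-- `(p, l)` is mapped to the list of the indexed points in `l` that start before `p` or have a
smaller index. -/
def filterBefore : Code :=
  ite (isPair (snd x₀))
    (ite (lt (fst (snd (fst (snd x₀)))) (fst (snd (fst x₀))))
      (mk (fst (snd x₀)) (call 12 (mk (fst x₀) (snd (snd x₀)))))
      (ite (lt (fst (fst (snd x₀))) (fst (fst x₀)))
        (mk (fst (snd x₀)) (call 12 (mk (fst x₀) (snd (snd x₀)))))
        (call 12 (mk (fst x₀) (snd (snd x₀))))))
    (const 0)

/-- Tests whether two lists of coordinates differ by at most one in each coordinate. -/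
def close : Code :=
  ite (isPair (fst x₀))
    (ite (le (sub (fst (fst x₀)) (fst (snd x₀))) oneR)
      (ite (le (sub (fst (snd x₀)) (fst (fst x₀))) oneR)
        (call 13 (mk (snd (fst x₀)) (snd (snd x₀))))
        (const 0))
      (const 0))
    (const 1)

/-- `((p, q), (l, l'))` is mapped to the list of the triples of indices of `p`, `q`, `s`, where `s`
is a point in `l` near `q`, followed by `l'`. -/
def pairsWith : Code :=
  ite (isPair (fst (snd x₀)))
    (ite (call 13 (mk (snd (snd (snd (snd (fst x₀)))))
        (snd (snd (snd (fst (fst (snd x₀))))))))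
      (mk (mk (fst (fst (fst x₀))) (mk (fst (snd (fst x₀))) (fst (fst (fst (snd x₀))))))
        (call 14 (mk (fst x₀) (mk (snd (fst (snd x₀))) (snd (snd x₀))))))
      (call 14 (mk (fst x₀) (mk (snd (fst (snd x₀))) (snd (snd x₀))))))
    (snd (snd x₀))

/-- `(p, (l, l'))` is mapped to the list of the triples of indices of `p`, `q`, `s`, where `q` and
`s` are points in `l` near each other, `q` occurring before `s`, followed by `l'`. -/
def pairs : Code :=
  ite (isPair (fst (snd x₀)))
    (call 14 (mk (mk (fst x₀) (fst (fst (snd x₀)))) (mk (snd (fst (snd x₀)))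
      (call 15 (mk (fst x₀) (mk (snd (fst (snd x₀))) (snd (snd x₀))))))))
    (snd (snd x₀))

/-- `(l, (τ, v))` is mapped to the list of the `τ`-durable triangles whose last starting vertex is in
the list `l` of points, where `v` is the range tree of all points. -/
def report : Code :=
  ite (isPair (fst x₀))
    (bind (fst (fst (fst x₀)))
      (ite (le (fst (snd x₁)) (sub (fst (snd (snd x₀))) (fst (snd x₀))))
        (call 15 (mk x₀ (mk
          (call 12 (mk x₀ (call 8 (mk (snd (snd x₁)) (mk
            (mk (fst (snd x₀))
              (mk (sub zeroR (add (fst (snd x₀)) (fst (snd x₁))))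
                (call 10 (snd (snd (snd x₀))))))
            (const 0))))))
          (call 16 (mk (snd (fst x₁)) (snd x₁))))))
        (call 16 (mk (snd (fst x₁)) (snd x₁)))))
    (const 0)

/-- The main procedure. -/
def main (d : ℕ) : Code :=
  bind (call 11 (mk (snd x₀) (const 0)))
    (call 16 (mk x₀ (mk (fst x₁) (call 6 (mk (const (2 * d + 2)) x₀)))))

end Code

/-- The program that reports the durable triangles among points of `ℝ^d`. The number of a procedure
in `Code.call` is its position in this list. -/
def trianglesProgram (d : ℕ) : Program :=
  [.main d, .appendFst, .halve, .merge, .sort, .tails, .build, .tree, .query, .coordKeys,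
    .coordBounds, .number, .filterBefore, .close, .pairsWith, .pairs, .report]

/-! ### Splitting and sorting lists -/

variable {d : ℕ}

theorem calls_halve : ∀ f l : List Val, f.length ≤ l.length →
    Calls (trianglesProgram d) 2 (.pair (.ofList l) (.ofList f))
      (.pair (.ofList (l.take (f.length / 2))) (.ofList (l.drop (f.length / 2))))
      (20 * f.length + 20)
  | [], l, _ => by
    refine .of_wp .halve rfl ?_
    simp [wp, Code.halve, Op1.run, Op2.run, Val.ofList]
  | [_], l, _ => by
    refine .of_wp .halve rfl ?_
    simp [wp, Code.halve, Op1.run, Op2.run, Val.ofList]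
  | a :: b :: f, [], h => by simp at h
  | a :: b :: f, x :: l, h => by
    have ih := calls_halve f l (by simp at h; omega)
    refine .of_wp .halve rfl ?_
    have e : (a :: b :: f).length / 2 = f.length / 2 + 1 := by simp only [List.length_cons]; omega
    simp only [wp, Code.halve, Op1.run, Op2.run, Val.ofList, e, List.getElem?_cons_zero,
      Option.some.injEq, exists_eq_left', Val.nat.injEq, one_ne_zero, if_false,
      List.getElem?_cons_succ]
    refine ⟨_, _, ih, ?_⟩
    simp [Val.ofList]
    omega

/-- A payload with a list of keys, as a value of the machine. -/
def encItem {α : Type*} (pay : α → Val) (a : α × List ℝ) : Val :=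
  .pair (pay a.1) (.ofList (a.2.map .real))

/-- A list of payloads with keys, as a value of the machine. -/
def encItems {α : Type*} (pay : α → Val) (l : List (α × List ℝ)) : Val :=
  .ofList (l.map (encItem pay))

/-- The order of items used for sorting. -/
def FirstKeyLE {α : Type*} (a b : α × List ℝ) : Prop := a.2.headI ≤ b.2.headI

theorem calls_appendFst {α : Type*} (pay : α → Val) (acc : List Val) :
    ∀ l : List (α × List ℝ), Calls (trianglesProgram d) 1
      (.pair (encItems pay l) (.ofList acc)) (.ofList (l.map (fun a => pay a.1) ++ acc))
      (20 * l.length + 20)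
  | [] => by
    refine .of_wp .appendFst rfl ?_
    simp only [wp, Op1.run, Op2.run, Val.ofList, List.getElem?_cons_zero, List.getElem?_cons_succ,
      Option.some.injEq, exists_eq_left', Val.nat.injEq, one_ne_zero, if_true, if_false,
      Nat.reduceAdd, Code.appendFst, encItems, List.map_nil, List.nil_append]
    simp
  | a :: l => by
    have ih := calls_appendFst pay acc l
    refine .of_wp .appendFst rfl ?_
    simp only [wp, Op1.run, Op2.run, Val.ofList, List.getElem?_cons_zero, List.getElem?_cons_succ,
      Option.some.injEq, exists_eq_left', Val.nat.injEq, one_ne_zero, if_true, if_false,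
      Nat.reduceAdd, Code.appendFst, encItems, encItem, List.map_cons, List.cons_append]
    exact ⟨_, _, ih, rfl, by simp only [List.length_cons]; omega⟩

theorem calls_tails {α : Type*} (pay : α → Val) :
    ∀ l : List (α × List ℝ), (∀ a ∈ l, a.2 ≠ []) → Calls (trianglesProgram d) 5
      (encItems pay l) (encItems pay (l.map fun a => (a.1, a.2.tail)))
      (20 * l.length + 20)
  | [], _ => by
    refine .of_wp .tails rfl ?_
    simp only [wp, Op1.run, Op2.run, Val.ofList, List.getElem?_cons_zero, List.getElem?_cons_succ,
      Option.some.injEq, exists_eq_left', Val.nat.injEq, one_ne_zero, if_true, if_false,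
      Nat.reduceAdd, Code.tails, encItems, List.map_nil]
    simp
  | (a, []) :: l, h => by simp at h
  | (a, k :: ks) :: l, h => by
    have ih := calls_tails pay l (fun b hb => h b (by simp [hb]))
    refine .of_wp .tails rfl ?_
    simp only [wp, Op1.run, Op2.run, Val.ofList, List.getElem?_cons_zero, List.getElem?_cons_succ,
      Option.some.injEq, exists_eq_left', Val.nat.injEq, one_ne_zero, if_true, if_false,
      Nat.reduceAdd, Code.tails, encItems, encItem, List.map_cons]
    exact ⟨_, _, ih, rfl, by simp only [List.length_cons]; omega⟩

theorem calls_merge {α : Type*} (pay : α → Val) : ∀ a b : List (α × List ℝ),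
    a.Pairwise FirstKeyLE → b.Pairwise FirstKeyLE → (∀ x ∈ a, x.2 ≠ []) → (∀ x ∈ b, x.2 ≠ []) →
    ∃ r : List (α × List ℝ), r.Perm (a ++ b) ∧ r.Pairwise FirstKeyLE ∧
      Calls (trianglesProgram d) 3 (.pair (encItems pay a) (encItems pay b)) (encItems pay r)
        (40 * (a.length + b.length) + 20)
  | [], b, _, hb, _, _ => by
    refine ⟨b, by simp, hb, .of_wp .merge rfl ?_⟩
    simp only [wp, Op1.run, Op2.run, Val.ofList, List.getElem?_cons_zero, List.getElem?_cons_succ,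
      Option.some.injEq, exists_eq_left', Val.nat.injEq, one_ne_zero, if_true, if_false,
      Nat.reduceAdd, Code.merge, encItems, List.map_cons, List.map_nil]
    simp
  | x :: a, [], ha, _, _, _ => by
    refine ⟨x :: a, by simp, ha, .of_wp .merge rfl ?_⟩
    simp only [wp, Op1.run, Op2.run, Val.ofList, List.getElem?_cons_zero, List.getElem?_cons_succ,
      Option.some.injEq, exists_eq_left', Val.nat.injEq, one_ne_zero, if_true, if_false,
      Nat.reduceAdd, Code.merge, encItems, List.map_cons, List.map_nil]
    simp
  | (x, []) :: a, y :: b, ha, hb, ha', hb' => by simp at ha'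
  | x :: a, (y, []) :: b, ha, hb, ha', hb' => by simp at hb'
  | (x, k :: ks) :: a, (y, k' :: ks') :: b, ha, hb, ha', hb' => by
    rw [List.pairwise_cons] at ha hb
    by_cases h : k ≤ k'
    · obtain ⟨r, hr, hs, ih⟩ := calls_merge pay a ((y, k' :: ks') :: b) ha.2
        (List.pairwise_cons.2 hb) (fun z hz => ha' z (by simp [hz])) hb'
      refine ⟨(x, k :: ks) :: r, hr.cons _, List.pairwise_cons.2 ⟨fun z hz => ?_, hs⟩,
        .of_wp .merge rfl ?_⟩
      · rcases List.mem_append.1 (hr.subset hz) with hz | hz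
        · exact ha.1 z hz
        · rcases List.mem_cons.1 hz with rfl | hz
          · exact h
          · exact le_trans (b := k') h (hb.1 z hz)
      · simp only [wp, Op1.run, Op2.run, Val.ofList, List.getElem?_cons_zero,
          List.getElem?_cons_succ, Option.some.injEq, exists_eq_left', Val.nat.injEq, one_ne_zero,
          if_true, if_false, Nat.reduceAdd, Code.merge, encItems, encItem, List.map_cons,
          Val.ofProp, h]
        exact ⟨_, _, ih, rfl, by simp only [List.length_cons]; omega⟩
    · obtain ⟨r, hr, hs, ih⟩ := calls_merge pay ((x, k :: ks) :: a) b (List.pairwise_cons.2 ha)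
        hb.2 ha' (fun z hz => hb' z (by simp [hz]))
      refine ⟨(y, k' :: ks') :: r, ((hr.cons _).trans List.perm_middle.symm),
        List.pairwise_cons.2 ⟨fun z hz => ?_, hs⟩, .of_wp .merge rfl ?_⟩
      · rcases List.mem_append.1 (hr.subset hz) with hz | hz
        · rcases List.mem_cons.1 hz with rfl | hz
          · exact (not_le.1 h).le
          · exact le_trans (b := k) (not_le.1 h).le (ha.1 z hz)
        · exact hb.1 z hz
      · simp only [wp, Op1.run, Op2.run, Val.ofList, List.getElem?_cons_zero,
          List.getElem?_cons_succ, Option.some.injEq, exists_eq_left', Val.nat.injEq, one_ne_zero,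
          if_true, if_false, Nat.reduceAdd, Code.merge, encItems, encItem, List.map_cons,
          Val.ofProp, h]
        exact ⟨_, _, ih, rfl, by simp only [List.length_cons]; omega⟩
  termination_by a b => a.length + b.length

/-- Merge sort makes `O(m h)` steps on a list of length `m ≤ 2 ^ h`. -/
theorem calls_sort {α : Type*} (pay : α → Val) : ∀ (h : ℕ) (l : List (α × List ℝ)),
    l.length ≤ 2 ^ h → (∀ x ∈ l, x.2 ≠ []) →
    ∃ r : List (α × List ℝ), r.Perm l ∧ r.Pairwise FirstKeyLE ∧
      Calls (trianglesProgram d) 4 (encItems pay l) (encItems pay r)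
        (200 * l.length * h + 20)
  | _, [], _, _ => by
    refine ⟨[], .refl _, by simp, .of_wp .sort rfl ?_⟩
    simp only [wp, Op1.run, Op2.run, Val.ofList, List.getElem?_cons_zero, List.getElem?_cons_succ,
      Option.some.injEq, exists_eq_left', Val.nat.injEq, one_ne_zero, if_true, if_false,
      Nat.reduceAdd, Code.sort, encItems, List.map_cons, List.map_nil]
    simp
  | _, [x], _, _ => by
    refine ⟨[x], .refl _, by simp, .of_wp .sort rfl ?_⟩
    simp only [wp, Op1.run, Op2.run, Val.ofList, List.getElem?_cons_zero, List.getElem?_cons_succ,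
      Option.some.injEq, exists_eq_left', Val.nat.injEq, one_ne_zero, if_true, if_false,
      Nat.reduceAdd, Code.sort, encItems, List.map_cons, List.map_nil]
    simp
  | 0, x :: y :: l, hl, _ => by simp at hl
  | h + 1, x :: y :: l, hl, hne => by
    obtain ⟨m, hm⟩ : ∃ m, m = x :: y :: l := ⟨_, rfl⟩
    rw [← hm] at hl hne ⊢
    have hm2 : 2 ≤ m.length := by simp [hm]
    have l₁ : (m.take (m.length / 2)).length = m.length / 2 := by simp; omega
    have l₂ : (m.drop (m.length / 2)).length = m.length - m.length / 2 := by simp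
    have hp : 2 ^ (h + 1) = 2 * 2 ^ h := by ring
    obtain ⟨r₁, p₁, s₁, c₁⟩ := calls_sort pay h (m.take (m.length / 2)) (by omega)
      (fun z hz => hne z (List.mem_of_mem_take hz))
    obtain ⟨r₂, p₂, s₂, c₂⟩ := calls_sort pay h (m.drop (m.length / 2)) (by omega)
      (fun z hz => hne z (List.mem_of_mem_drop hz))
    obtain ⟨r, p, s, c⟩ := calls_merge (d := d) pay r₁ r₂ s₁ s₂
      (fun z hz => hne z (List.mem_of_mem_take (p₁.subset hz)))
      (fun z hz => hne z (List.mem_of_mem_drop (p₂.subset hz)))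
    have ch := calls_halve (d := d) (m.map (encItem pay)) (m.map (encItem pay)) le_rfl
    refine ⟨r, p.trans ?_, s, .of_wp .sort rfl ?_⟩
    · conv_rhs => rw [← List.take_append_drop (m.length / 2) m]
      exact p₁.append p₂
    · rw [l₁] at c₁
      rw [l₂] at c₂
      rw [p₁.length_eq, p₂.length_eq, l₁, l₂] at c
      rw [← List.map_take, ← List.map_drop, List.length_map] at ch
      have hlen : 200 * m.length * (h + 1) = 200 * (m.length / 2) * h +
          200 * (m.length - m.length / 2) * h + 200 * m.length := by
        rw [← Nat.add_mul, ← Nat.mul_add, Nat.add_sub_cancel' (Nat.div_le_self _ _), Nat.mul_succ]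
      rw [hlen]
      have e : encItems pay m = .pair (encItem pay x) (.pair (encItem pay y) (encItems pay l)) := by
        simp [hm, encItems, Val.ofList]
      simp only [wp, Op1.run, Op2.run, Val.ofList, List.getElem?_cons_zero,
        List.getElem?_cons_succ, Option.some.injEq, exists_eq_left', Val.nat.injEq, one_ne_zero,
        if_true, if_false, Nat.reduceAdd, Code.sort, e]
      rw [← e]
      refine ⟨_, _, ch, ?_⟩
      simp only [Option.some.injEq, exists_eq_left']
      exact ⟨_, _, c₁, _, _, c₂, _, _, c, rfl, by omega⟩

/-! ### Range trees -/

open Classical in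
/-- The payloads of the items whose keys are at most the entries of `ys`. -/
noncomputable def dominated {α : Type*} (ys : List ℝ) (l : List (α × List ℝ)) : List α :=
  (l.filter fun a => List.Forall₂ (· ≤ ·) a.2 ys).map Prod.fst

theorem dominated_append {α : Type*} (ys : List ℝ) (l l' : List (α × List ℝ)) :
    dominated ys (l ++ l') = dominated ys l ++ dominated ys l' := by
  simp [dominated]

theorem dominated_perm {α : Type*} (ys : List ℝ) {l l' : List (α × List ℝ)} (h : l.Perm l') :
    (dominated ys l).Perm (dominated ys l') :=
  (h.filter _).map _

theorem dominated_eq_nil {α : Type*} {y : ℝ} {ys : List ℝ} {l : List (α × List ℝ)}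
    (hne : ∀ a ∈ l, a.2 ≠ []) (h : ∀ a ∈ l, y < a.2.headI) : dominated (y :: ys) l = [] := by
  simp only [dominated, List.map_eq_nil_iff, List.filter_eq_nil_iff, decide_eq_true_eq]
  rintro ⟨a, _ | ⟨k, ks⟩⟩ ha h'
  · exact hne _ ha rfl
  · exact (h _ ha).not_ge (List.forall₂_cons.1 h').1

theorem dominated_cons_of_le {α : Type*} {y : ℝ} {ys : List ℝ} {l : List (α × List ℝ)}
    (hne : ∀ a ∈ l, a.2 ≠ []) (h : ∀ a ∈ l, a.2.headI ≤ y) :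
    dominated (y :: ys) l = dominated ys (l.map fun a => (a.1, a.2.tail)) := by
  simp only [dominated, List.filter_map, List.map_map]
  have : l.filter (fun a => List.Forall₂ (· ≤ ·) a.2 (y :: ys)) = l.filter
      ((fun a : α × List ℝ => decide (List.Forall₂ (· ≤ ·) a.2 ys)) ∘ fun a => (a.1, a.2.tail)) := by
    refine List.filter_congr ?_
    rintro ⟨a, _ | ⟨k, ks⟩⟩ ha
    · exact absurd rfl (hne _ ha)
    · have : k ≤ y := h _ ha
      simp only [List.forall₂_cons, this, true_and, Function.comp_apply, List.tail_cons]
      exact decide_eq_decide.2 Iff.rfl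
  rw [this]
  rfl

/-- The value `v` can be queried as a range tree of the list `l` of items with `D` keys each, with
at most `B` steps per query in addition to a constant number of steps per reported item. The items
may be reported in any order. -/
def IsRangeTree {α : Type*} (d : ℕ) (pay : α → Val) (D B : ℕ) (l : List (α × List ℝ)) (v : Val) :
    Prop :=
  ∀ ys : List ℝ, ys.length = D → ∃ r : List α, r.Perm (dominated ys l) ∧ ∀ acc : List Val,
    Calls (trianglesProgram d) 8 (.pair v (.pair (.ofList (ys.map .real)) (.ofList acc)))
      (.ofList (r.map pay ++ acc)) (B + 20 * r.length)

theorem IsRangeTree.mono {α : Type*} {pay : α → Val} {D B B' : ℕ} {l : List (α × List ℝ)}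
    {v : Val} (h : IsRangeTree d pay D B l v) (hB : B ≤ B') : IsRangeTree d pay D B' l v := by
  intro ys hys
  obtain ⟨r, hr, hc⟩ := h ys hys
  exact ⟨r, hr, fun acc => (hc acc).mono (by omega)⟩

theorem IsRangeTree.perm {α : Type*} {pay : α → Val} {D B : ℕ} {l l' : List (α × List ℝ)}
    {v : Val} (h : IsRangeTree d pay D B l v) (hl : l.Perm l') : IsRangeTree d pay D B l' v := by
  intro ys hys
  obtain ⟨r, hr, hc⟩ := h ys hys
  exact ⟨r, hr.trans (dominated_perm ys hl), hc⟩

theorem isRangeTree_zero {α : Type*} (pay : α → Val) (l : List (α × List ℝ))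
    (hl : ∀ a ∈ l, a.2.length = 0) : IsRangeTree d pay 0 50 l (encItems pay l) := by
  intro ys hys
  obtain rfl : ys = [] := List.length_eq_zero_iff.1 hys
  refine ⟨l.map Prod.fst, ?_, fun acc => ?_⟩
  · have : l.filter (fun a => List.Forall₂ (· ≤ ·) a.2 []) = l :=
      List.filter_eq_self.2 fun a ha => by simp [List.length_eq_zero_iff.1 (hl a ha)]
    rw [dominated, this]
  · have h := calls_appendFst (d := d) pay acc l
    refine .of_wp .query rfl ?_
    simp only [wp, Op1.run, Op2.run, Val.ofList, List.getElem?_cons_zero, List.getElem?_cons_succ,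
      Option.some.injEq, exists_eq_left', Val.nat.injEq, one_ne_zero, if_true, if_false,
      Nat.reduceAdd, Code.query, List.map_nil]
    refine ⟨_, _, h, ?_, ?_⟩
    · rw [List.map_map]
      rfl
    · rw [List.length_map]
      omega

theorem isRangeTree_nil {α : Type*} (pay : α → Val) (D : ℕ) :
    IsRangeTree d pay (D + 1) 50 [] (.nat 0) := by
  rintro (_ | ⟨y, ys⟩) hys
  · simp at hys
  · refine ⟨[], by simp [dominated], fun acc => .of_wp .query rfl ?_⟩
    simp only [wp, Op1.run, Op2.run, Val.ofList, List.getElem?_cons_zero, List.getElem?_cons_succ,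
      Option.some.injEq, exists_eq_left', Val.nat.injEq, one_ne_zero, if_true, if_false,
      Nat.reduceAdd, Code.query, List.map_cons, List.map_nil, List.nil_append]
    simp

/-- A node of a range tree: the items in `l₁` and `x` have first keys at most that of `x`, so that a
query with an entry not below the key of `x` need not look at these keys again. -/
theorem IsRangeTree.node {α : Type*} {pay : α → Val} {D B B' : ℕ} {l₁ l₂ : List (α × List ℝ)}
    {x : α × List ℝ} {v v₁ v₂ : Val} (hs : (l₁ ++ x :: l₂).Pairwise FirstKeyLE)
    (hne : ∀ a ∈ l₁ ++ x :: l₂, a.2 ≠ [])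
    (hv : IsRangeTree d pay D B ((x :: l₁).map fun a => (a.1, a.2.tail)) v)
    (hv₁ : IsRangeTree d pay (D + 1) B' l₁ v₁) (hv₂ : IsRangeTree d pay (D + 1) B' l₂ v₂) :
    IsRangeTree d pay (D + 1) (B + B' + 70) (l₁ ++ x :: l₂)
      (.pair (.real x.2.headI) (.pair v (.pair v₁ v₂))) := by
  rintro (_ | ⟨y, ys⟩) hys
  · simp at hys
  have hys' : ys.length = D := by simpa using hys
  have hle : ∀ a ∈ x :: l₁, a.2.headI ≤ x.2.headI := by
    intro a ha
    rcases List.mem_cons.1 ha with rfl | ha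
    · exact le_rfl
    · exact (List.pairwise_append.1 hs).2.2 a ha x (by simp)
  have hge : ∀ a ∈ x :: l₂, x.2.headI ≤ a.2.headI := by
    intro a ha
    rcases List.mem_cons.1 ha with rfl | ha
    · exact le_rfl
    · exact (List.pairwise_cons.1 (List.pairwise_append.1 hs).2.1).1 a ha
  by_cases h : x.2.headI ≤ y
  · obtain ⟨r, hr, hc⟩ := hv ys hys'
    obtain ⟨r₂, hr₂, hc₂⟩ := hv₂ (y :: ys) hys
    refine ⟨r₂ ++ r, ?_, fun acc => ?_⟩
    · have e : (l₁ ++ x :: l₂).Perm (l₂ ++ x :: l₁) := by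
        refine (List.perm_append_comm).trans ?_
        rw [List.cons_append]
        exact List.perm_middle.symm
      refine ((hr₂.append hr).trans ?_).trans (dominated_perm _ e.symm)
      rw [dominated_append, dominated_cons_of_le (l := x :: l₁) _ fun a ha => (hle a ha).trans h]
      intro a ha
      refine hne a ?_
      simp only [List.mem_cons, List.mem_append] at ha ⊢
      tauto
    · have c := hc acc
      have c₂ := hc₂ (r.map pay ++ acc)
      refine .of_wp .query rfl ?_
      simp only [wp, Op1.run, Op2.run, Val.ofList, List.getElem?_cons_zero,
        List.getElem?_cons_succ, Option.some.injEq, exists_eq_left', Val.nat.injEq, one_ne_zero,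
        if_true, if_false, Nat.reduceAdd, Code.query, List.map_cons, Val.ofProp, h]
      exact ⟨_, _, c, _, _, c₂, by rw [List.map_append, List.append_assoc],
        by rw [List.length_append]; omega⟩
  · obtain ⟨r₁, hr₁, hc₁⟩ := hv₁ (y :: ys) hys
    refine ⟨r₁, ?_, fun acc => ?_⟩
    · rw [dominated_append, dominated_eq_nil (l := x :: l₂), List.append_nil]
      · exact hr₁
      · intro a ha
        exact hne a (by simp only [List.mem_cons, List.mem_append] at ha ⊢; tauto)
      · exact fun a ha => (not_le.1 h).trans_le (hge a ha)
    · have c := hc₁ acc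
      refine .of_wp .query rfl ?_
      simp only [wp, Op1.run, Op2.run, Val.ofList, List.getElem?_cons_zero,
        List.getElem?_cons_succ, Option.some.injEq, exists_eq_left', Val.nat.injEq, one_ne_zero,
        if_true, if_false, Nat.reduceAdd, Code.query, List.map_cons, Val.ofProp, h]
      exact ⟨_, _, c, rfl, by omega⟩

/-- Every list of fewer than `2 ^ L` items with `D` keys each has a range tree with `B` steps of
overhead per query, constructed with `K` steps per item and `K` further steps. -/
def Buildable {α : Type*} (d : ℕ) (pay : α → Val) (L D B K : ℕ) : Prop :=
  ∀ l : List (α × List ℝ), l.length < 2 ^ L → (∀ a ∈ l, a.2.length = D) →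
    ∃ v, Calls (trianglesProgram d) 6 (.pair (.nat D) (encItems pay l)) v (K * (l.length + 1)) ∧
      IsRangeTree d pay D B l v

/-- A range tree over sorted items has one node per item and logarithmic height, and every item
occurs at most once per level in the trees for the remaining keys. -/
theorem calls_tree {α : Type*} {pay : α → Val} {L D B K : ℕ} (hb : Buildable d pay L D B K) :
    ∀ (h : ℕ) (l : List (α × List ℝ)), h ≤ L → l.length < 2 ^ h → l.Pairwise FirstKeyLE →
      (∀ a ∈ l, a.2.length = D + 1) →
      ∃ v, Calls (trianglesProgram d) 7 (.pair (.nat D) (encItems pay l)) v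
          ((2 * K + 200) * l.length * h + 20) ∧
        IsRangeTree d pay (D + 1) (h * (B + 70) + 50) l v
  | h, [], hL, hl, _, hD => by
    refine ⟨.nat 0, .of_wp .tree rfl ?_, (isRangeTree_nil pay D).mono (by omega)⟩
    simp only [wp, Op1.run, Op2.run, Val.ofList, List.getElem?_cons_zero, List.getElem?_cons_succ,
      Option.some.injEq, exists_eq_left', Val.nat.injEq, one_ne_zero, if_true, if_false,
      Nat.reduceAdd, Code.tree, encItems, List.map_nil]
    simp
  | 0, a :: l, hL, hl, _, hD => by simp at hl
  | h + 1, a :: l, hL, hl, hs, hD => by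
    obtain ⟨m, hm⟩ : ∃ m, m = a :: l := ⟨_, rfl⟩
    rw [← hm] at hl hs hD ⊢
    have hm1 : 1 ≤ m.length := by simp [hm]
    obtain ⟨l₁, x, l₂, rfl, h₁⟩ : ∃ l₁ x l₂, m = l₁ ++ x :: l₂ ∧ l₁.length = m.length / 2 := by
      have hlt : m.length / 2 < m.length := by omega
      refine ⟨m.take (m.length / 2), m[m.length / 2], m.drop (m.length / 2 + 1), ?_, ?_⟩
      · rw [List.getElem_cons_drop, List.take_append_drop]
      · rw [List.length_take]
        omega
    have hp : 2 ^ (h + 1) = 2 * 2 ^ h := by ring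
    have hpL : 2 ^ (h + 1) ≤ 2 ^ L := Nat.pow_le_pow_right (by norm_num) hL
    have hlen : (l₁ ++ x :: l₂).length = l₁.length + l₂.length + 1 := by
      rw [List.length_append, List.length_cons]
      omega
    rw [hlen] at hl h₁
    have hne : ∀ b ∈ l₁ ++ x :: l₂, b.2 ≠ [] := by
      intro b hb e
      have := hD b hb
      simp [e] at this
    obtain ⟨v₁, c₁, t₁⟩ := calls_tree hb h l₁ (by omega) (by omega) (List.pairwise_append.1 hs).1
      (fun b hb => hD b (by simp [hb]))
    obtain ⟨v₂, c₂, t₂⟩ := calls_tree hb h l₂ (by omega) (by omega)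
      (List.pairwise_cons.1 (List.pairwise_append.1 hs).2.1).2
      (fun b hb => hD b (by simp [hb]))
    have hmem : ∀ b ∈ x :: l₁, b ∈ l₁ ++ x :: l₂ := by
      intro b hb
      simp only [List.mem_cons, List.mem_append] at hb ⊢
      tauto
    have ct := calls_tails (d := d) pay (x :: l₁) (fun b hb => hne b (hmem b hb))
    obtain ⟨v, c, t⟩ := hb ((x :: l₁).map fun a => (a.1, a.2.tail))
      (by simp only [List.length_map, List.length_cons]; omega)
      (by
        intro b hb
        obtain ⟨b', hb', rfl⟩ := List.mem_map.1 hb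
        simp [hD b' (hmem b' hb')])
    refine ⟨_, ?_, (IsRangeTree.node hs hne t t₁ t₂).mono (by ring_nf; omega)⟩
    have ch := calls_halve (d := d) ((l₁ ++ x :: l₂).map (encItem pay))
      ((l₁ ++ x :: l₂).map (encItem pay)) le_rfl
    have htake : (l₁ ++ x :: l₂).take (l₁.length) = l₁ := by simp
    have hdrop : (l₁ ++ x :: l₂).drop (l₁.length) = x :: l₂ := by simp
    rw [← List.map_take, ← List.map_drop, List.length_map, hlen, ← h₁, htake, hdrop] at ch
    obtain ⟨x, _ | ⟨k, ks⟩⟩ := x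
    · exact absurd rfl (hne (x, []) (by simp))
    have e : encItems pay (l₁ ++ (x, k :: ks) :: l₂) =
        .pair (encItem pay a) (encItems pay l) := by
      rw [hm]
      rfl
    rw [List.length_map, List.length_cons] at c
    rw [List.length_cons] at ct
    refine .of_wp .tree rfl ?_
    simp only [wp, Op1.run, Op2.run, Val.ofList, List.getElem?_cons_zero, List.getElem?_cons_succ,
      Option.some.injEq, exists_eq_left', Val.nat.injEq, one_ne_zero, if_true, if_false,
      Nat.reduceAdd, Code.tree, e]
    rw [← e]
    refine ⟨_, _, ch, ?_⟩
    simp only [Option.some.injEq, exists_eq_left', List.map_cons, Val.ofList, encItem]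
    refine ⟨_, _, ct, _, _, c, _, _, c₁, _, _, c₂, rfl, ?_⟩
    rw [hlen]
    have hK : K * (l₁.length + 1 + 1) ≤ 2 * K * (l₁.length + l₂.length + 1) := by
      rw [mul_comm 2 K, mul_assoc]
      exact Nat.mul_le_mul_left _ (by omega)
    have hmul : (2 * K + 200) * (l₁.length + l₂.length + 1) * (h + 1) =
        (2 * K + 200) * l₁.length * h + (2 * K + 200) * l₂.length * h +
        2 * K * (l₁.length + l₂.length + 1) + 200 * (l₁.length + l₂.length + 1) +
        (2 * K + 200) * h := by
      ring
    omega

theorem buildable_zero {α : Type*} (pay : α → Val) (L : ℕ) : Buildable d pay L 0 50 50 := by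
  intro l _ hl
  refine ⟨_, .of_wp .build rfl ?_, isRangeTree_zero pay l hl⟩
  simp only [wp, Op1.run, Op2.run, Val.ofList, List.getElem?_cons_zero, List.getElem?_cons_succ,
    Option.some.injEq, exists_eq_left', Val.nat.injEq, one_ne_zero, if_true, if_false,
    Nat.reduceAdd, Code.build, true_and]
  omega

theorem Buildable.succ {α : Type*} {pay : α → Val} {L D B K : ℕ} (hb : Buildable d pay L D B K) :
    Buildable d pay L (D + 1) (L * (B + 70) + 50) ((2 * K + 400) * L + 100) := by
  intro l hl hD
  obtain ⟨r, hr, hs, c⟩ := calls_sort (d := d) pay L l hl.le (by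
    intro x hx e
    have := hD x hx
    simp [e] at this)
  obtain ⟨v, c', t⟩ := calls_tree hb L r le_rfl (hr.length_eq ▸ hl) hs
    (fun a ha => hD a (hr.subset ha))
  refine ⟨v, .of_wp .build rfl ?_, t.perm hr⟩
  simp only [wp, Op1.run, Op2.run, Val.ofList, List.getElem?_cons_zero, List.getElem?_cons_succ,
    Option.some.injEq, exists_eq_left', Val.nat.injEq, one_ne_zero, if_true, if_false,
    Nat.reduceAdd, Code.build, Nat.add_eq_zero_iff, and_false, Nat.add_sub_cancel]
  refine ⟨_, _, c, _, _, c', rfl, ?_⟩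
  rw [hr.length_eq]
  have : ((2 * K + 400) * L + 100) * (l.length + 1) = 200 * l.length * L +
    (2 * K + 200) * l.length * L + (2 * K + 400) * L + 100 * l.length + 100 := by ring
  omega

/-- Range trees with `D` keys of fewer than `2 ^ L` items take `O(L ^ D)` steps per item to construct,
and `O(L ^ D)` steps per query. -/
theorem buildable {α : Type*} (pay : α → Val) {L : ℕ} (hL : 1 ≤ L) :
    ∀ D, Buildable d pay L D (1000 ^ (D + 1) * L ^ D) (1000 ^ (D + 1) * L ^ D)
  | 0 => by
    intro l h₁ h₂
    obtain ⟨v, c, t⟩ := buildable_zero (d := d) pay L l h₁ h₂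
    refine ⟨v, c.mono ?_, t.mono (by norm_num)⟩
    simp only [zero_add, pow_one, pow_zero, mul_one]
    omega
  | D + 1 => by
    have hx : 1000 ≤ 1000 ^ (D + 1) * L ^ D := by
      have h₁ : 1 ≤ 1000 ^ D * L ^ D := Nat.mul_pos (by positivity) (by positivity)
      calc 1000 ≤ 1000 * (1000 ^ D * L ^ D) := by omega
        _ = _ := by ring
    have e : 1000 ^ (D + 1 + 1) * L ^ (D + 1) = 1000 * (1000 ^ (D + 1) * L ^ D) * L := by ring
    rw [e]
    intro l h₁ h₂
    obtain ⟨v, c, t⟩ := (buildable pay hL D).succ l h₁ h₂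
    generalize 1000 ^ (D + 1) * L ^ D = X at *
    refine ⟨v, c.mono (Nat.mul_le_mul_right _ ?_), t.mono ?_⟩ <;> nlinarith

end RealRAM

namespace TemporalPoints

open RealRAM

variable {d n : ℕ}

/-! ### Points as items of a range tree -/

/-- A point together with its index, as a value of the machine. -/
def encodeIndexed (S : TemporalPoints d n) (i : Fin n) : Val :=
  .pair (.nat i) (S.encodePoint i)

/-- The keys `lo, -hi, x₁, -x₁, …, x_d, -x_d` of a point. -/
def keys (S : TemporalPoints d n) (i : Fin n) : List ℝ :=
  S.lo i :: -S.hi i :: (List.ofFn (S.pos i)).flatMap fun x => [x, -x]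

/-- Upper bounds for the keys of those points `q` near `p` whose lifespans contain
`[lo p, lo p + τ]`. -/
def bounds (S : TemporalPoints d n) (τ : ℝ) (p : Fin n) : List ℝ :=
  S.lo p :: -(S.lo p + τ) :: (List.ofFn (S.pos p)).flatMap fun x => [x + 1, 1 - x]

theorem length_flatMap_pair (f g : ℝ → ℝ) (l : List ℝ) :
    (l.flatMap fun x => [f x, g x]).length = 2 * l.length := by
  induction l with
  | nil => rfl
  | cons a l ih =>
    rw [List.flatMap_cons, List.length_append, ih]
    simp only [List.length_cons, List.length_nil]
    ring

theorem length_keys (S : TemporalPoints d n) (i : Fin n) : (S.keys i).length = 2 * d + 2 := by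
  simp [keys, -List.length_flatMap, length_flatMap_pair]

theorem length_bounds (S : TemporalPoints d n) (τ : ℝ) (i : Fin n) :
    (S.bounds τ i).length = 2 * d + 2 := by
  simp [bounds, -List.length_flatMap, length_flatMap_pair]

theorem forall₂_flatMap_iff : ∀ xs ys : List ℝ,
    List.Forall₂ (· ≤ ·) (ys.flatMap fun x => [x, -x]) (xs.flatMap fun x => [x + 1, 1 - x]) ↔
      List.Forall₂ (fun x y => x - y ≤ 1 ∧ y - x ≤ 1) xs ys
  | [], [] => by simp
  | [], y :: ys => by simp
  | x :: xs, [] => by simp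
  | x :: xs, y :: ys => by
    simp only [List.flatMap_cons, List.cons_append, List.nil_append, List.forall₂_cons,
      forall₂_flatMap_iff xs ys, ← and_assoc]
    refine and_congr_left fun _ => ?_
    constructor <;> rintro ⟨h₁, h₂⟩ <;> constructor <;> linarith

theorem forall₂_ofFn_iff (R : ℝ → ℝ → Prop) (f g : Fin d → ℝ) :
    List.Forall₂ R (List.ofFn f) (List.ofFn g) ↔ ∀ k, R (f k) (g k) := by
  rw [List.forall₂_iff_get]
  simp [Fin.forall_iff]

theorem near_iff_dist_le (f g : Fin d → ℝ) :
    List.Forall₂ (fun x y => x - y ≤ 1 ∧ y - x ≤ 1) (List.ofFn f) (List.ofFn g) ↔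
      dist f g ≤ 1 := by
  rw [forall₂_ofFn_iff, dist_pi_le_iff zero_le_one]
  refine forall_congr' fun k => ?_
  rw [Real.dist_eq, abs_le]
  constructor <;> rintro ⟨h₁, h₂⟩ <;> constructor <;> linarith

theorem forall₂_keys_bounds_iff (S : TemporalPoints d n) (τ : ℝ) (p q : Fin n) :
    List.Forall₂ (· ≤ ·) (S.keys q) (S.bounds τ p) ↔
      S.lo q ≤ S.lo p ∧ S.lo p + τ ≤ S.hi q ∧ dist (S.pos p) (S.pos q) ≤ 1 := by
  rw [keys, bounds, List.forall₂_cons, List.forall₂_cons, neg_le_neg_iff, forall₂_flatMap_iff,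
    near_iff_dist_le]

theorem encodePoint_eq (S : TemporalPoints d n) (i : Fin n) : S.encodePoint i =
    .pair (.real (S.lo i)) (.pair (.real (S.hi i)) (.ofList ((List.ofFn (S.pos i)).map .real))) := by
  rw [encodePoint, List.map_ofFn]
  rfl

theorem calls_coordKeys {d' : ℕ} : ∀ xs : List ℝ, Calls (trianglesProgram d') 9
    (.ofList (xs.map .real)) (.ofList ((xs.flatMap fun x => [x, -x]).map .real))
    (30 * xs.length + 20)
  | [] => by
    refine .of_wp .coordKeys rfl ?_
    simp only [wp, Op1.run, Op2.run, Val.ofList, List.getElem?_cons_zero, List.getElem?_cons_succ,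
      Option.some.injEq, exists_eq_left', Val.nat.injEq, one_ne_zero, if_true, if_false,
      Nat.reduceAdd, Code.coordKeys, List.map_nil, List.flatMap_nil, true_and]
    omega
  | x :: xs => by
    have ih := calls_coordKeys (d' := d') xs
    refine .of_wp .coordKeys rfl ?_
    simp only [wp, Op1.run, Op2.run, Val.ofList, List.getElem?_cons_zero, List.getElem?_cons_succ,
      Option.some.injEq, exists_eq_left', Val.nat.injEq, one_ne_zero, if_true, if_false,
      Nat.reduceAdd, Code.coordKeys, List.map_cons, Nat.cast_zero, zero_sub]
    exact ⟨_, _, ih, rfl, by rw [List.length_cons]; omega⟩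

theorem calls_coordBounds {d' : ℕ} : ∀ xs : List ℝ, Calls (trianglesProgram d') 10
    (.ofList (xs.map .real)) (.ofList ((xs.flatMap fun x => [x + 1, 1 - x]).map .real))
    (30 * xs.length + 20)
  | [] => by
    refine .of_wp .coordBounds rfl ?_
    simp only [wp, Op1.run, Op2.run, Val.ofList, List.getElem?_cons_zero, List.getElem?_cons_succ,
      Option.some.injEq, exists_eq_left', Val.nat.injEq, one_ne_zero, if_true, if_false,
      Nat.reduceAdd, Code.coordBounds, List.map_nil, List.flatMap_nil, true_and]
    omega
  | x :: xs => by
    have ih := calls_coordBounds (d' := d') xs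
    refine .of_wp .coordBounds rfl ?_
    simp only [wp, Op1.run, Op2.run, Val.ofList, List.getElem?_cons_zero, List.getElem?_cons_succ,
      Option.some.injEq, exists_eq_left', Val.nat.injEq, one_ne_zero, if_true, if_false,
      Nat.reduceAdd, Code.coordBounds, List.map_cons, Nat.cast_one]
    exact ⟨_, _, ih, rfl, by rw [List.length_cons]; omega⟩

theorem calls_number (S : TemporalPoints d n) : ∀ (l : List (Fin n)) (k : ℕ),
    l.map Fin.val = List.range' k l.length → Calls (trianglesProgram d) 11
      (.pair (.ofList (l.map S.encodePoint)) (.nat k))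
      (encItems S.encodeIndexed (l.map fun i => (i, S.keys i))) ((30 * d + 100) * l.length + 20)
  | [], k, _ => by
    refine .of_wp .number rfl ?_
    simp only [wp, Op1.run, Op2.run, Val.ofList, List.getElem?_cons_zero, List.getElem?_cons_succ,
      Option.some.injEq, exists_eq_left', Val.nat.injEq, one_ne_zero, if_true, if_false,
      Nat.reduceAdd, Code.number, List.map_nil, encItems, true_and]
    omega
  | i :: l, k, h => by
    rw [List.map_cons, List.length_cons, List.range'_succ, List.cons.injEq] at h
    obtain ⟨rfl, h⟩ := h
    have ih := calls_number S l _ h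
    have c := calls_coordKeys (d' := d) (List.ofFn (S.pos i))
    rw [List.length_ofFn] at c
    refine .of_wp .number rfl ?_
    simp only [wp, Op1.run, Op2.run, Val.ofList, List.getElem?_cons_zero, List.getElem?_cons_succ,
      Option.some.injEq, exists_eq_left', Val.nat.injEq, one_ne_zero, if_true, if_false,
      Nat.reduceAdd, Code.number, List.map_cons, encItems, encItem, encodePoint_eq, encodeIndexed,
      keys, Nat.cast_zero, zero_sub]
    refine ⟨_, _, c, _, _, ih, rfl, ?_⟩
    rw [List.length_cons, mul_add]
    omega

/-! ### Reporting triangles with a given last vertex -/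

theorem calls_filterBefore (S : TemporalPoints d n) (p : Fin n) : ∀ l : List (Fin n),
    Calls (trianglesProgram d) 12
      (.pair (S.encodeIndexed p) (.ofList (l.map S.encodeIndexed)))
      (.ofList ((l.filter fun q => S.lo q < S.lo p ∨ q < p).map S.encodeIndexed))
      (60 * l.length + 20)
  | [] => by
    refine .of_wp .filterBefore rfl ?_
    simp only [wp, Op1.run, Op2.run, Val.ofList, List.getElem?_cons_zero, List.getElem?_cons_succ,
      Option.some.injEq, exists_eq_left', Val.nat.injEq, one_ne_zero, if_true, if_false,
      Nat.reduceAdd, Code.filterBefore, List.map_nil, List.filter_nil, true_and]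
    omega
  | q :: l => by
    have ih := calls_filterBefore S p l
    refine .of_wp .filterBefore rfl ?_
    rw [List.filter_cons]
    by_cases h₁ : S.lo q < S.lo p
    · simp only [wp, Op1.run, Op2.run, Val.ofList, List.getElem?_cons_zero,
        List.getElem?_cons_succ, Option.some.injEq, exists_eq_left', Val.nat.injEq, one_ne_zero,
        if_true, if_false, Nat.reduceAdd, Code.filterBefore, List.map_cons, encodeIndexed,
        encodePoint_eq, Val.ofProp, h₁, true_or, decide_true]
      simp only [encodeIndexed, encodePoint_eq] at ih
      exact ⟨_, _, ih, rfl, by rw [List.length_cons]; omega⟩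
    · by_cases h₂ : q < p
      · have h₂' : (q : ℕ) < p := h₂
        simp only [wp, Op1.run, Op2.run, Val.ofList, List.getElem?_cons_zero,
          List.getElem?_cons_succ, Option.some.injEq, exists_eq_left', Val.nat.injEq, one_ne_zero,
          if_true, if_false, Nat.reduceAdd, Code.filterBefore, List.map_cons, encodeIndexed,
          encodePoint_eq, Val.ofProp, h₁, h₂, h₂', or_true, decide_true]
        simp only [encodeIndexed, encodePoint_eq] at ih
        exact ⟨_, _, ih, rfl, by rw [List.length_cons]; omega⟩
      · have h₂' : ¬ (q : ℕ) < p := h₂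
        simp only [wp, Op1.run, Op2.run, Val.ofList, List.getElem?_cons_zero,
          List.getElem?_cons_succ, Option.some.injEq, exists_eq_left', Val.nat.injEq, one_ne_zero,
          if_true, if_false, Nat.reduceAdd, Code.filterBefore, List.map_cons, encodeIndexed,
          encodePoint_eq, Val.ofProp, h₁, h₂, h₂', or_false, decide_false, Bool.false_eq_true]
        simp only [encodeIndexed, encodePoint_eq] at ih
        exact ⟨_, _, ih, rfl, by rw [List.length_cons]; omega⟩

theorem calls_close {d' : ℕ} : ∀ xs ys : List ℝ, xs.length = ys.length →
    Calls (trianglesProgram d') 13 (.pair (.ofList (xs.map .real)) (.ofList (ys.map .real)))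
      (Val.ofProp (List.Forall₂ (fun x y => x - y ≤ 1 ∧ y - x ≤ 1) xs ys)) (40 * xs.length + 20)
  | [], [], _ => by
    refine .of_wp .close rfl ?_
    simp only [wp, Op1.run, Op2.run, Val.ofList, List.getElem?_cons_zero, List.getElem?_cons_succ,
      Option.some.injEq, exists_eq_left', Val.nat.injEq, one_ne_zero, if_true, if_false,
      Nat.reduceAdd, Code.close, List.map_nil, List.Forall₂.nil, Val.ofProp, true_and]
    omega
  | [], y :: ys, h => by simp at h
  | x :: xs, [], h => by simp at h
  | x :: xs, y :: ys, h => by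
    have ih := calls_close (d' := d') xs ys (by simpa using h)
    refine .of_wp .close rfl ?_
    by_cases h₁ : x - y ≤ 1
    · by_cases h₂ : y - x ≤ 1
      · rw [List.forall₂_cons, and_iff_right (And.intro h₁ h₂)]
        simp only [wp, Op1.run, Op2.run, Val.ofList, List.getElem?_cons_zero,
          List.getElem?_cons_succ, Option.some.injEq, exists_eq_left', Val.nat.injEq, one_ne_zero,
          if_true, if_false, Nat.reduceAdd, Code.close, List.map_cons, Val.ofProp, h₁, h₂,
          Nat.cast_one]
        exact ⟨_, _, ih, by rw [Val.ofProp], by rw [List.length_cons]; omega⟩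
      · simp only [wp, Op1.run, Op2.run, Val.ofList, List.getElem?_cons_zero,
          List.getElem?_cons_succ, Option.some.injEq, exists_eq_left', Val.nat.injEq, one_ne_zero,
          if_true, if_false, Nat.reduceAdd, Code.close, List.map_cons, List.forall₂_cons,
          Val.ofProp, h₁, h₂, true_and, false_and, and_false, Nat.cast_one]
        rw [List.length_cons]
        omega
    · simp only [wp, Op1.run, Op2.run, Val.ofList, List.getElem?_cons_zero,
        List.getElem?_cons_succ, Option.some.injEq, exists_eq_left', Val.nat.injEq, one_ne_zero,
        if_true, if_false, Nat.reduceAdd, Code.close, List.map_cons, List.forall₂_cons, Val.ofProp,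
        h₁, true_and, false_and, Nat.cast_one]
      rw [List.length_cons]
      omega

theorem calls_pairsWith (S : TemporalPoints d n) (p q : Fin n)
    (acc : List (Fin n × Fin n × Fin n)) : ∀ l : List (Fin n),
    Calls (trianglesProgram d) 14
      (.pair (.pair (S.encodeIndexed p) (S.encodeIndexed q))
        (.pair (.ofList (l.map S.encodeIndexed)) (encodeTriples acc)))
      (encodeTriples ((l.filter fun s => dist (S.pos q) (S.pos s) ≤ 1).map (fun s => (p, q, s)) ++ acc))
      ((40 * d + 120) * l.length + 20)
  | [] => by
    refine .of_wp .pairsWith rfl ?_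
    simp only [wp, Op1.run, Op2.run, Val.ofList, List.getElem?_cons_zero, List.getElem?_cons_succ,
      Option.some.injEq, exists_eq_left', Val.nat.injEq, one_ne_zero, if_true, if_false,
      Nat.reduceAdd, Code.pairsWith, List.map_nil, List.filter_nil, List.nil_append, true_and]
    omega
  | s :: l => by
    have ih := calls_pairsWith S p q acc l
    have c := calls_close (d' := d) (List.ofFn (S.pos q)) (List.ofFn (S.pos s)) (by simp)
    rw [near_iff_dist_le, List.length_ofFn] at c
    refine .of_wp .pairsWith rfl ?_
    rw [List.filter_cons, List.length_cons, mul_add]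
    by_cases h : dist (S.pos q) (S.pos s) ≤ 1
    · rw [Val.ofProp, if_pos h] at c
      simp only [wp, Op1.run, Op2.run, Val.ofList, List.getElem?_cons_zero,
        List.getElem?_cons_succ, Option.some.injEq, exists_eq_left', Val.nat.injEq, one_ne_zero,
        if_true, if_false, Nat.reduceAdd, Code.pairsWith, List.map_cons, encodeIndexed,
        encodePoint_eq, h, decide_true]
      simp only [encodeIndexed, encodePoint_eq] at ih
      refine ⟨_, _, c, ?_⟩
      simp only [Val.nat.injEq, exists_eq_left', one_ne_zero, if_true, if_false]
      exact ⟨_, _, ih, rfl, by omega⟩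
    · rw [Val.ofProp, if_neg h] at c
      simp only [wp, Op1.run, Op2.run, Val.ofList, List.getElem?_cons_zero,
        List.getElem?_cons_succ, Option.some.injEq, exists_eq_left', Val.nat.injEq, one_ne_zero,
        if_true, if_false, Nat.reduceAdd, Code.pairsWith, List.map_cons, encodeIndexed,
        encodePoint_eq, h, decide_false, Bool.false_eq_true]
      simp only [encodeIndexed, encodePoint_eq] at ih
      refine ⟨_, _, c, ?_⟩
      simp only [Val.nat.injEq, exists_eq_left', one_ne_zero, if_true, if_false]
      exact ⟨_, _, ih, rfl, by omega⟩

/-- The triples of `p` and two points in a list near each other. -/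
noncomputable def nearPairs (S : TemporalPoints d n) (p : Fin n) :
    List (Fin n) → List (Fin n × Fin n × Fin n)
  | [] => []
  | q :: l =>
    (l.filter fun s => dist (S.pos q) (S.pos s) ≤ 1).map (fun s => (p, q, s)) ++ nearPairs S p l

theorem calls_pairs (S : TemporalPoints d n) (p : Fin n)
    (acc : List (Fin n × Fin n × Fin n)) : ∀ l : List (Fin n),
    Calls (trianglesProgram d) 15
      (.pair (S.encodeIndexed p) (.pair (.ofList (l.map S.encodeIndexed)) (encodeTriples acc)))
      (encodeTriples (S.nearPairs p l ++ acc)) ((40 * d + 150) * (l.length + 1) ^ 2)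
  | [] => by
    refine .of_wp .pairs rfl ?_
    simp only [wp, Op1.run, Op2.run, Val.ofList, List.getElem?_cons_zero, List.getElem?_cons_succ,
      Option.some.injEq, exists_eq_left', Val.nat.injEq, one_ne_zero, if_true, if_false,
      Nat.reduceAdd, Code.pairs, List.map_nil, nearPairs, List.nil_append, true_and,
      List.length_nil, zero_add, one_pow]
    omega
  | q :: l => by
    have ih := calls_pairs S p acc l
    have c := S.calls_pairsWith p q (S.nearPairs p l ++ acc) l
    refine .of_wp .pairs rfl ?_
    simp only [wp, Op1.run, Op2.run, Val.ofList, List.getElem?_cons_zero, List.getElem?_cons_succ,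
      Option.some.injEq, exists_eq_left', Val.nat.injEq, one_ne_zero, if_true, if_false,
      Nat.reduceAdd, Code.pairs, List.map_cons]
    refine ⟨_, _, ih, _, _, c, by rw [nearPairs, List.append_assoc], ?_⟩
    have e : (40 * d + 150) * ((q :: l).length + 1) ^ 2 = (40 * d + 150) * (l.length + 1) ^ 2 +
      2 * ((40 * d + 120) * l.length) + 60 * l.length + 3 * (40 * d + 150) := by
      rw [List.length_cons]
      ring
    omega

/-- The triangles reported for the vertex `p`, if the range tree answers the query for `p` with the
list `r`. -/
noncomputable def reported (S : TemporalPoints d n) (τ : ℝ) (p : Fin n) (r : List (Fin n)) :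
    List (Fin n × Fin n × Fin n) :=
  if τ ≤ S.hi p - S.lo p then S.nearPairs p (r.filter fun q => S.lo q < S.lo p ∨ q < p) else []

set_option maxRecDepth 4000 in
theorem calls_report (S : TemporalPoints d n) (τ : ℝ) (v : Val) (B : ℕ)
    (r : Fin n → List (Fin n))
    (hr : ∀ p, Calls (trianglesProgram d) 8
      (.pair v (.pair (.ofList ((S.bounds τ p).map .real)) (.nat 0)))
      (.ofList ((r p).map S.encodeIndexed)) (B + 20 * (r p).length)) :
    ∀ l : List (Fin n), Calls (trianglesProgram d) 16
      (.pair (encItems S.encodeIndexed (l.map fun i => (i, S.keys i))) (.pair (.real τ) v))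
      (encodeTriples (l.flatMap fun p => S.reported τ p (r p)))
      (20 + (l.map fun p => B + 200 + 30 * d + if τ ≤ S.hi p - S.lo p then
        (40 * d + 300) * ((r p).length + 1) ^ 2 else 0).sum)
  | [] => by
    refine .of_wp .report rfl ?_
    simp only [wp, Op1.run, Op2.run, Val.ofList, List.getElem?_cons_zero, List.getElem?_cons_succ,
      Option.some.injEq, exists_eq_left', Val.nat.injEq, one_ne_zero, if_true, if_false,
      Nat.reduceAdd, Code.report, List.map_nil, List.flatMap_nil, encItems, encodeTriples, true_and]
    simp
  | p :: l => by
    have ih := calls_report S τ v B r hr l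
    refine .of_wp .report rfl ?_
    rw [List.map_cons, List.map_cons, List.sum_cons, List.flatMap_cons]
    generalize (l.map fun p => B + 200 + 30 * d + if τ ≤ S.hi p - S.lo p then
        (40 * d + 300) * ((r p).length + 1) ^ 2 else 0).sum = T at ih ⊢
    by_cases h : τ ≤ S.hi p - S.lo p
    · have cb := calls_coordBounds (d' := d) (List.ofFn (S.pos p))
      rw [List.length_ofFn] at cb
      have cq := hr p
      have cf := S.calls_filterBefore p (r p)
      have cp := S.calls_pairs p (l.flatMap fun p => S.reported τ p (r p))
        ((r p).filter fun q => S.lo q < S.lo p ∨ q < p)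
      replace cp := cp.mono (Nat.mul_le_mul_left _ (Nat.pow_le_pow_left
        (Nat.add_le_add_right (List.length_filter_le _ _) 1) 2))
      rw [reported, if_pos h, if_pos h]
      simp only [encodeIndexed, encodePoint_eq, bounds, List.map_cons, Val.ofList] at cq cf cp
      simp only [wp, Op1.run, Op2.run, Val.ofList, List.getElem?_cons_zero,
        List.getElem?_cons_succ, Option.some.injEq, exists_eq_left', Val.nat.injEq, one_ne_zero,
        if_true, if_false, Nat.reduceAdd, Code.report, List.map_cons, encItems, encItem,
        encodeIndexed, encodePoint_eq, Val.ofProp, h, Nat.cast_zero, zero_sub]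
      refine ⟨_, _, cb, _, _, cq, _, _, cf, _, _, ih, _, _, cp, rfl, ?_⟩
      have : (40 * d + 300) * ((r p).length + 1) ^ 2 =
        (40 * d + 150) * ((r p).length + 1) ^ 2 + 150 * (r p).length ^ 2 + 300 * (r p).length + 150 := by
        ring
      omega
    · rw [reported, if_neg h, if_neg h]
      simp only [wp, Op1.run, Op2.run, Val.ofList, List.getElem?_cons_zero,
        List.getElem?_cons_succ, Option.some.injEq, exists_eq_left', Val.nat.injEq, one_ne_zero,
        if_true, if_false, Nat.reduceAdd, Code.report, List.map_cons, encItems, encItem,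
        encodeIndexed, encodePoint_eq, Val.ofProp, h]
      refine ⟨_, _, ih, rfl, ?_⟩
      omega

/-! ### Durable triangles -/

theorem le_volume_iInter_lifespan_iff (S : TemporalPoints d n) {τ : ℝ} (hτ : 0 < τ)
    {s : Finset (Fin n)} (hs : s.Nonempty) :
    ENNReal.ofReal τ ≤ volume (⋂ i ∈ s, S.lifespan i) ↔
      ∀ i ∈ s, ∀ j ∈ s, S.lo i + τ ≤ S.hi j := by
  have e : (⋂ i ∈ s, S.lifespan i) = Set.Icc (s.sup' hs S.lo) (s.inf' hs S.hi) := by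
    ext x
    simp only [lifespan, Set.mem_iInter, Set.mem_Icc, Finset.sup'_le_iff, Finset.le_inf'_iff]
    exact forall₂_and
  rw [e, Real.volume_Icc, ENNReal.ofReal_le_ofReal_iff', or_iff_left hτ.not_ge, le_sub_iff_add_le,
    Finset.le_inf'_iff]
  constructor
  · intro h i hi j hj
    linarith [h j hj, Finset.le_sup' S.lo hi]
  · intro h j hj
    rw [← le_sub_iff_add_le', Finset.sup'_le_iff]
    intro i hi
    linarith [h i hi j hj]

theorem mem_durableTriangles_iff (S : TemporalPoints d n) {τ : ℝ} (hτ : 0 < τ)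
    {s : Finset (Fin n)} : s ∈ S.durableTriangles τ ↔
      S.unitDiskGraph.IsNClique 3 s ∧ ∀ i ∈ s, ∀ j ∈ s, S.lo i + τ ≤ S.hi j := by
  refine and_congr_right fun h => S.le_volume_iInter_lifespan_iff hτ ?_
  rw [← Finset.card_pos, h.card_eq]
  norm_num

/-- The point `q` is near `p`, and its lifespan contains `[lo p, lo p + τ]`. -/
def Covers (S : TemporalPoints d n) (τ : ℝ) (p q : Fin n) : Prop :=
  S.lo q ≤ S.lo p ∧ S.lo p + τ ≤ S.hi q ∧ dist (S.pos p) (S.pos q) ≤ 1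

/-- Two near points that cover a point form a durable triangle with it. -/
theorem Covers.mem_durableTriangles {S : TemporalPoints d n} {τ : ℝ} (hτ : 0 < τ) {p q s : Fin n}
    (hp : τ ≤ S.hi p - S.lo p) (hq : S.Covers τ p q) (hs : S.Covers τ p s) (hpq : p ≠ q)
    (hps : p ≠ s) (hqs : q ≠ s) (h : dist (S.pos q) (S.pos s) ≤ 1) :
    ({p, q, s} : Finset (Fin n)) ∈ S.durableTriangles τ := by
  rw [mem_durableTriangles_iff S hτ, SimpleGraph.is3Clique_triple_iff]
  refine ⟨⟨⟨hpq, hq.2.2⟩, ⟨hps, hs.2.2⟩, ⟨hqs, h⟩⟩, fun i hi j hj => ?_⟩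
  have h₁ : S.lo i ≤ S.lo p := by
    simp only [Finset.mem_insert, Finset.mem_singleton] at hi
    rcases hi with rfl | rfl | rfl
    exacts [le_rfl, hq.1, hs.1]
  have h₂ : S.lo p + τ ≤ S.hi j := by
    simp only [Finset.mem_insert, Finset.mem_singleton] at hj
    rcases hj with rfl | rfl | rfl
    exacts [by linarith, hq.2.1, hs.2.1]
  linarith

/-! ### Correctness of the output -/

/-- The set of the entries of a triple. -/
abbrev vertexSet (t : Fin n × Fin n × Fin n) : Finset (Fin n) := {t.1, t.2.1, t.2.2}

theorem mem_nearPairs {S : TemporalPoints d n} {p : Fin n} {t : Fin n × Fin n × Fin n} :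
    ∀ {l : List (Fin n)}, l.Nodup → t ∈ S.nearPairs p l →
      t.1 = p ∧ t.2.1 ∈ l ∧ t.2.2 ∈ l ∧ t.2.1 ≠ t.2.2 ∧ dist (S.pos t.2.1) (S.pos t.2.2) ≤ 1
  | [], _, h => by simp [nearPairs] at h
  | q :: l, hl, h => by
    rw [List.nodup_cons] at hl
    rw [nearPairs, List.mem_append] at h
    rcases h with h | h
    · obtain ⟨s, hs, rfl⟩ := List.mem_map.1 h
      rw [List.mem_filter, decide_eq_true_eq] at hs
      exact ⟨rfl, by simp, by simp [hs.1], fun e => hl.1 ((show q = s from e) ▸ hs.1), hs.2⟩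
    · obtain ⟨h₁, h₂, h₃, h₄⟩ := mem_nearPairs hl.2 h
      exact ⟨h₁, List.mem_cons_of_mem _ h₂, List.mem_cons_of_mem _ h₃, h₄⟩

theorem exists_mem_nearPairs {S : TemporalPoints d n} (p : Fin n) {b c : Fin n} (hbc : b ≠ c)
    (h : dist (S.pos b) (S.pos c) ≤ 1) : ∀ {l : List (Fin n)}, b ∈ l → c ∈ l →
      ∃ t ∈ S.nearPairs p l, vertexSet t = {p, b, c}
  | [], hb, _ => by simp at hb
  | q :: l, hb, hc => by
    rw [nearPairs]
    rcases List.mem_cons.1 hb with rfl | hb'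
    · have hc : c ∈ l := (List.mem_cons.1 hc).resolve_left hbc.symm
      exact ⟨(p, b, c), List.mem_append_left _ (List.mem_map.2 ⟨c, by simp [hc, h], rfl⟩), rfl⟩
    · rcases List.mem_cons.1 hc with e | hc
      · subst e
        rw [dist_comm] at h
        refine ⟨(p, c, b), List.mem_append_left _ (List.mem_map.2 ⟨b, by simp [hb', h], rfl⟩), ?_⟩
        rw [vertexSet, Finset.pair_comm]
      · obtain ⟨t, ht, e⟩ := exists_mem_nearPairs p hbc h hb' hc
        exact ⟨t, List.mem_append_right _ ht, e⟩

theorem nodup_nearPairs (S : TemporalPoints d n) {p : Fin n} :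
    ∀ {l : List (Fin n)}, l.Nodup → p ∉ l → ((S.nearPairs p l).map vertexSet).Nodup
  | [], _, _ => by simp [nearPairs]
  | q :: l, hl, hp => by
    rw [List.nodup_cons] at hl
    rw [List.mem_cons, not_or] at hp
    rw [nearPairs, List.map_append, List.nodup_append']
    refine ⟨?_, nodup_nearPairs S hl.2 hp.2, ?_⟩
    · rw [List.map_map]
      refine List.Nodup.map_on ?_ (hl.2.filter _)
      intro x hx y hy e
      have hx' := List.mem_of_mem_filter hx
      have : x ∈ ({p, q, y} : Finset (Fin n)) := by
        rw [show ({p, q, y} : Finset (Fin n)) = {p, q, x} from e.symm]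
        simp
      simp only [Finset.mem_insert, Finset.mem_singleton] at this
      rcases this with rfl | rfl | h
      exacts [absurd hx' hp.2, absurd hx' hl.1, h]
    · intro s hs hs'
      rw [List.map_map] at hs
      obtain ⟨x, hx, rfl⟩ := List.mem_map.1 hs
      obtain ⟨t, ht, e⟩ := List.mem_map.1 hs'
      obtain ⟨h₁, h₂, h₃, -⟩ := mem_nearPairs hl.2 ht
      have : q ∈ vertexSet t := by rw [e]; simp
      simp only [vertexSet, Finset.mem_insert, Finset.mem_singleton] at this
      rcases this with h | h | h
      · exact hp.1 (h₁.symm.trans h.symm)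
      · exact hl.1 (h ▸ h₂)
      · exact hl.1 (h ▸ h₃)

/-- A vertex set reported for `p` has `p` as its last vertex. -/
theorem last_of_mem_reported {S : TemporalPoints d n} {τ : ℝ} {p : Fin n} {r : List (Fin n)}
    (hn : r.Nodup) (hr : ∀ q, q ∈ r ↔ S.Covers τ p q) {t : Fin n × Fin n × Fin n}
    (ht : t ∈ S.reported τ p r) : p ∈ vertexSet t ∧
      ∀ i ∈ vertexSet t, i = p ∨ S.lo i ≤ S.lo p ∧ (S.lo i < S.lo p ∨ i < p) := by
  rw [reported] at ht
  split_ifs at ht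
  · obtain ⟨h₁, h₂, h₃, -⟩ := mem_nearPairs (hn.filter _) ht
    refine ⟨by simp [vertexSet, h₁], fun i hi => ?_⟩
    rw [List.mem_filter, decide_eq_true_eq, hr] at h₂ h₃
    simp only [vertexSet, Finset.mem_insert, Finset.mem_singleton] at hi
    rcases hi with rfl | rfl | rfl
    exacts [.inl h₁, .inr ⟨h₂.1.1, h₂.2⟩, .inr ⟨h₃.1.1, h₃.2⟩]
  · simp at ht

theorem reportsOnce_flatMap_reported (S : TemporalPoints d n) {τ : ℝ} (hτ : 0 < τ)
    (r : Fin n → List (Fin n)) (hn : ∀ p, (r p).Nodup)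
    (hr : ∀ p q, q ∈ r p ↔ S.Covers τ p q) :
    ReportsOnce (encodeTriples ((List.finRange n).flatMap fun p => S.reported τ p (r p)))
      (S.durableTriangles τ) := by
  refine ⟨_, rfl, ?_, fun s => ?_⟩
  · rw [List.map_flatMap, List.nodup_flatMap]
    constructor
    · intro p _
      rw [reported]
      split_ifs
      · refine S.nodup_nearPairs ((hn p).filter _) fun h => ?_
        simp at h
      · simp
    · refine (List.nodup_finRange n).imp fun {p p'} hne s hs hs' => hne ?_
      obtain ⟨t, ht, rfl⟩ := List.mem_map.1 hs
      obtain ⟨t', ht', e⟩ := List.mem_map.1 hs'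
      obtain ⟨h₁, h₂⟩ := last_of_mem_reported (hn p) (hr p) ht
      obtain ⟨h₁', h₂'⟩ := last_of_mem_reported (hn p') (hr p') ht'
      replace e : vertexSet t' = vertexSet t := e
      rw [e] at h₁' h₂'
      rcases h₂ p' h₁' with h | ⟨h, h'⟩
      · exact h.symm
      · rcases h₂' p h₁ with g | ⟨g, g'⟩
        · exact g
        · rcases h' with h' | h'
          · linarith
          · rcases g' with g' | g'
            · linarith
            · exact absurd h' g'.not_gt
  · rw [List.mem_map]
    constructor
    · rintro ⟨t, ht, rfl⟩
      obtain ⟨p, -, ht⟩ := List.mem_flatMap.1 ht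
      rw [reported] at ht
      split_ifs at ht with hp
      · obtain ⟨h₁, h₂, h₃, h₄, h₅⟩ := mem_nearPairs ((hn p).filter _) ht
        rw [List.mem_filter, decide_eq_true_eq, hr] at h₂ h₃
        have hne : ∀ {q}, (S.lo q < S.lo p ∨ q < p) → p ≠ q := by
          rintro q h rfl
          simp at h
        rw [h₁]
        exact Covers.mem_durableTriangles hτ hp h₂.1 h₃.1 (hne h₂.2) (hne h₃.2) h₄ h₅
      · simp at ht
    · intro hs
      rw [mem_durableTriangles_iff S hτ] at hs
      obtain ⟨hc, hd⟩ := hs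
      obtain ⟨p, hp, hmax⟩ := s.exists_max_image (fun i => toLex (S.lo i, i))
        (Finset.card_pos.1 (by rw [hc.card_eq]; norm_num))
      obtain ⟨b, c, hbc, he⟩ := Finset.card_eq_two.1
        (show (s.erase p).card = 2 by rw [Finset.card_erase_of_mem hp, hc.card_eq])
      have hsp : s = {p, b, c} := by rw [← he, Finset.insert_erase hp]
      have key : ∀ q ∈ s.erase p, q ∈ (r p).filter fun q => S.lo q < S.lo p ∨ q < p := by
        intro q hq
        obtain ⟨hqp, hqs⟩ := Finset.mem_erase.1 hq
        rw [List.mem_filter, decide_eq_true_eq, hr]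
        have hm : S.lo q < S.lo p ∨ S.lo q = S.lo p ∧ q ≤ p := by
          simpa [Prod.Lex.toLex_le_toLex] using hmax q hqs
        refine ⟨⟨?_, hd p hp q hqs, (hc.isClique hp hqs (Ne.symm hqp)).2⟩, ?_⟩
        · rcases hm with h | h
          exacts [h.le, h.1.le]
        · exact hm.imp id fun h => lt_of_le_of_ne h.2 hqp
      have hb : b ∈ s.erase p := by rw [he]; simp
      have hcm : c ∈ s.erase p := by rw [he]; simp
      obtain ⟨t, ht, e⟩ := exists_mem_nearPairs (S := S) p hbc
        (hc.isClique (Finset.mem_of_mem_erase hb) (Finset.mem_of_mem_erase hcm) hbc).2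
        (key b hb) (key c hcm)
      refine ⟨t, List.mem_flatMap.2 ⟨p, List.mem_finRange p, ?_⟩, e.trans hsp.symm⟩
      rw [reported, if_pos]
      · exact ht
      · linarith [hd p hp p hp]

/-! ### The number of tested pairs -/

open Classical in
/-- By the pigeonhole principle, many of the points covering `p` lie in the same orthant of the unit
ball around `p`; these are near each other and hence form durable triangles with `p`. -/
theorem sq_card_covers_le (S : TemporalPoints d n) {τ : ℝ} (hτ : 0 < τ) {p : Fin n}
    (hp : τ ≤ S.hi p - S.lo p) (A : Finset (Fin n)) (hA : ∀ q ∈ A, q ≠ p ∧ S.Covers τ p q) :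
    A.card ^ 2 ≤ 2 ^ d * (3 * (Finset.univ.filter fun s : Finset (Fin n) =>
      s ∈ S.durableTriangles τ ∧ p ∈ s).card + A.card) := by
  set T := Finset.univ.filter fun s : Finset (Fin n) => s ∈ S.durableTriangles τ ∧ p ∈ s with hT
  let orthant : Fin n → Fin d → Bool := fun q k => decide (S.pos q k ≤ S.pos p k)
  set M := (A ×ˢ A).filter fun x => orthant x.1 = orthant x.2 with hM
  have h₁ : A.card ^ 2 ≤ 2 ^ d * M.card := by
    have e₁ : A.card = ∑ o : Fin d → Bool, (A.filter fun q => orthant q = o).card :=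
      Finset.card_eq_sum_card_fiberwise fun _ _ => Finset.mem_coe.2 (Finset.mem_univ _)
    have e₂ : M.card = ∑ o : Fin d → Bool, (A.filter fun q => orthant q = o).card ^ 2 := by
      rw [Finset.card_eq_sum_card_fiberwise (f := fun x => orthant x.1) (t := Finset.univ)
        fun _ _ => Finset.mem_coe.2 (Finset.mem_univ _)]
      refine Finset.sum_congr rfl fun o _ => ?_
      rw [sq, ← Finset.card_product]
      congr 1
      ext ⟨q, s⟩
      simp only [hM, Finset.mem_filter, Finset.mem_product]
      constructor
      · rintro ⟨⟨⟨h₁, h₂⟩, h₃⟩, h₄⟩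
        exact ⟨⟨h₁, h₄⟩, h₂, h₃ ▸ h₄⟩
      · rintro ⟨⟨h₁, h₂⟩, h₃, h₄⟩
        exact ⟨⟨⟨h₁, h₃⟩, h₂.trans h₄.symm⟩, h₂⟩
    rw [e₂, e₁]
    refine sq_sum_le_card_mul_sum_sq.trans_eq ?_
    simp
  have h₂ : M.card ≤ 3 * T.card + A.card := by
    rw [← Finset.card_filter_add_card_filter_not (s := M) fun x => x.1 ≠ x.2]
    refine Nat.add_le_add ?_ ?_
    · have e : (T.sigma fun s => s).card = 3 * T.card := by
        rw [Finset.card_sigma, Finset.sum_const_nat (m := 3), mul_comm]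
        intro s hs
        exact (Finset.mem_filter.1 hs).2.1.1.card_eq
      rw [← e]
      refine Finset.card_le_card_of_injOn (fun x => ⟨{p, x.1, x.2}, x.1⟩) ?_ ?_
      · rintro ⟨q, s⟩ hx
        simp only [hM, Finset.coe_filter, Finset.mem_filter, Finset.mem_product,
          Set.mem_ofPred_eq] at hx
        obtain ⟨⟨⟨hq, hs⟩, ho⟩, hne⟩ := hx
        simp only [Finset.coe_sigma, Set.mem_sigma_iff, Finset.mem_coe, hT, Finset.mem_filter,
          Finset.mem_univ, true_and]
        refine ⟨⟨Covers.mem_durableTriangles hτ hp (hA q hq).2 (hA s hs).2 (hA q hq).1.symm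
          (hA s hs).1.symm hne ?_, by simp⟩, by simp⟩
        -- two numbers at distance at most one from a third one, on the same side of it
        rw [dist_pi_le_iff zero_le_one]
        intro k
        have ho' := decide_eq_decide.1 (congrFun ho k)
        have hq' := (dist_pi_le_iff zero_le_one).1 (hA q hq).2.2.2 k
        have hs' := (dist_pi_le_iff zero_le_one).1 (hA s hs).2.2.2 k
        rw [Real.dist_eq, abs_le] at hq' hs' ⊢
        by_cases h : S.pos q k ≤ S.pos p k
        · have := ho'.1 h
          constructor <;> linarith
        · have := not_le.1 fun h' => h (ho'.2 h')
          constructor <;> linarith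
      · rintro ⟨q, s⟩ hx ⟨q', s'⟩ hx' e
        simp only [hM, Finset.coe_filter, Finset.mem_filter, Finset.mem_product,
          Set.mem_ofPred_eq] at hx hx'
        simp only [Sigma.mk.injEq, heq_eq_eq] at e
        obtain ⟨e, rfl⟩ := e
        have : s ∈ ({p, q, s'} : Finset (Fin n)) := by rw [← e]; simp
        simp only [Finset.mem_insert, Finset.mem_singleton] at this
        rcases this with h | h | h
        · exact absurd h (hA s hx.1.1.2).1
        · exact absurd h.symm hx.2
        · rw [h]
    · refine Finset.card_le_card_of_injOn Prod.fst ?_ ?_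
      · rintro ⟨q, s⟩ hx
        simp only [hM, Finset.coe_filter, Finset.mem_filter, Finset.mem_product,
          Set.mem_ofPred_eq] at hx
        exact hx.1.1.1
      · rintro ⟨q, s⟩ hx ⟨q', s'⟩ hx' e
        simp only [hM, Finset.coe_filter, Finset.mem_filter, Finset.mem_product,
          Set.mem_ofPred_eq, not_not] at hx hx' e
        rw [← hx.2, ← hx'.2, e]
  exact h₁.trans (Nat.mul_le_mul_left _ h₂)

open Classical in
theorem sum_card_durableTriangles_mem (S : TemporalPoints d n) (τ : ℝ) :
    ∑ p, (Finset.univ.filter fun s : Finset (Fin n) => s ∈ S.durableTriangles τ ∧ p ∈ s).card =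
      3 * (S.durableTriangles τ).ncard := by
  have h := Finset.sum_card_bipartiteAbove_eq_sum_card_bipartiteBelow
    (s := (Finset.univ : Finset (Fin n)))
    (t := Finset.univ.filter fun s : Finset (Fin n) => s ∈ S.durableTriangles τ)
    (fun p s => p ∈ s)
  simp only [Finset.bipartiteAbove, Finset.bipartiteBelow, Finset.filter_filter] at h
  rw [h, Set.ncard_eq_toFinset_card', Set.filter_mem_univ_eq_toFinset,
    Finset.sum_const_nat (m := 3), mul_comm]
  intro s hs
  rw [Finset.filter_univ_mem]
  exact (Set.mem_toFinset.1 hs).1.card_eq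

theorem sum_sq_length_le (S : TemporalPoints d n) {τ : ℝ} (hτ : 0 < τ)
    (r : Fin n → List (Fin n)) (hn : ∀ p, (r p).Nodup)
    (hr : ∀ p q, q ∈ r p ↔ S.Covers τ p q) :
    ∑ p, (if τ ≤ S.hi p - S.lo p then ((r p).length + 1) ^ 2 else 0) ≤
      100 * 4 ^ d * (n + (S.durableTriangles τ).ncard) := by
  classical
  have key : ∀ p, (if τ ≤ S.hi p - S.lo p then ((r p).length + 1) ^ 2 else 0) ≤
      100 * 4 ^ d + 12 * 2 ^ d * (Finset.univ.filter fun s : Finset (Fin n) =>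
        s ∈ S.durableTriangles τ ∧ p ∈ s).card := by
    intro p
    split_ifs with hp
    · have h := S.sq_card_covers_le hτ hp ((r p).toFinset.erase p) (fun q hq => by
        rw [Finset.mem_erase, List.mem_toFinset, hr] at hq
        exact hq)
      have hc : (r p).length ≤ ((r p).toFinset.erase p).card + 1 := by
        rw [← List.toFinset_card_of_nodup (hn p)]
        have := Finset.pred_card_le_card_erase (s := (r p).toFinset) (a := p)
        omega
      generalize ((r p).toFinset.erase p).card = k at h hc
      generalize (Finset.univ.filter fun s : Finset (Fin n) =>
        s ∈ S.durableTriangles τ ∧ p ∈ s).card = T at h ⊢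
      have h4 : 4 ^ d = 2 ^ d * 2 ^ d := by rw [← mul_pow]; norm_num
      rw [h4]
      have hD : 1 ≤ 2 ^ d := Nat.one_le_two_pow
      generalize 2 ^ d = D at h hD ⊢
      have h₁ : ((r p).length + 1) ^ 2 ≤ (k + 2) ^ 2 := Nat.pow_le_pow_left (by omega) 2
      -- `2 D k ≤ D ^ 2 + k ^ 2` absorbs the term `D k` of `h`
      zify at *
      nlinarith [sq_nonneg ((D : ℤ) - k), sq_nonneg ((k : ℤ) - 2)]
    · exact Nat.zero_le _
  refine (Finset.sum_le_sum fun p _ => key p).trans ?_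
  rw [Finset.sum_add_distrib, Finset.sum_const, ← Finset.mul_sum, sum_card_durableTriangles_mem,
    Finset.card_univ, Fintype.card_fin, smul_eq_mul]
  have : 2 ^ d ≤ 4 ^ d := Nat.pow_le_pow_left (by norm_num) d
  nlinarith [Nat.mul_le_mul_right (S.durableTriangles τ).ncard this,
    Nat.zero_le (4 ^ d * (S.durableTriangles τ).ncard)]

/-! ### The running time -/

theorem runs_trianglesProgram (S : TemporalPoints d n) {τ : ℝ} (hτ : 0 < τ) {L : ℕ} (hL : 1 ≤ L)
    (hn : n < 2 ^ L) : ∃ output t, (trianglesProgram d).Runs (S.encodeInput τ) output t ∧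
      ReportsOnce output (S.durableTriangles τ) ∧
      t ≤ 2 * 1000 ^ (2 * d + 3) * L ^ (2 * d + 2) * (n + 1) + (300 + 60 * d) * (n + 1) +
        (40 * d + 300) * (100 * 4 ^ d * (n + (S.durableTriangles τ).ncard)) := by
  classical
  let items := (List.finRange n).map fun i => (i, S.keys i)
  have hlen : items.length = n := by simp [items]
  obtain ⟨v, cb, tree⟩ := buildable (d := d) S.encodeIndexed hL (2 * d + 2) items
    (by rw [hlen]; exact hn) (by simp [items, length_keys])
  have cn := S.calls_number (List.finRange n) 0 (by simp [List.range_eq_range'])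
  rw [List.length_finRange] at cn
  rw [hlen] at cb
  set B := 1000 ^ (2 * d + 2 + 1) * L ^ (2 * d + 2) with hB
  choose r hr hq using fun p => tree (S.bounds τ p) (S.length_bounds τ p)
  have hdom : ∀ p, dominated (S.bounds τ p) items =
      (List.finRange n).filter fun q => S.Covers τ p q := by
    intro p
    simp only [dominated, items, List.filter_map, List.map_map]
    rw [show (Prod.fst ∘ fun i => (i, S.keys i)) = (id : Fin n → Fin n) from rfl, List.map_id]
    exact List.filter_congr fun q _ => decide_eq_decide.2 (S.forall₂_keys_bounds_iff τ p q)
  have hnd : ∀ p, (r p).Nodup := fun p =>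
    (hr p).nodup_iff.2 (hdom p ▸ (List.nodup_finRange n).filter _)
  have hmem : ∀ p q, q ∈ r p ↔ S.Covers τ p q := by
    intro p q
    rw [(hr p).mem_iff, hdom]
    simp
  have cr := S.calls_report τ v B r (fun p => by simpa [Val.ofList] using hq p []) (List.finRange n)
  have hsum' : ∀ f : Fin n → ℕ, ((List.finRange n).map f).sum = ∑ p, f p := fun f => by
    rw [← List.ofFn_eq_map, List.sum_ofFn]
  rw [hsum', Finset.sum_add_distrib, Finset.sum_const,
    Finset.card_univ, Fintype.card_fin, smul_eq_mul] at cr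
  have hsum := S.sum_sq_length_le hτ r hnd hmem
  have c : Calls (trianglesProgram d) 0 (S.encodeInput τ)
      (encodeTriples ((List.finRange n).flatMap fun p => S.reported τ p (r p)))
      (2 * 1000 ^ (2 * d + 3) * L ^ (2 * d + 2) * (n + 1) + (300 + 60 * d) * (n + 1) +
        (40 * d + 300) * (100 * 4 ^ d * (n + (S.durableTriangles τ).ncard))) := by
    refine .of_wp (.main d) rfl ?_
    simp only [wp, Op1.run, Op2.run, Val.ofList, List.getElem?_cons_zero, List.getElem?_cons_succ,
      Option.some.injEq, exists_eq_left', Val.nat.injEq, one_ne_zero, if_true, if_false,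
      Nat.reduceAdd, Code.main, encodeInput, List.ofFn_eq_map]
    refine ⟨_, _, cn, _, _, cb, _, _, cr, rfl, ?_⟩
    have e : ∑ p, (if τ ≤ S.hi p - S.lo p then (40 * d + 300) * ((r p).length + 1) ^ 2 else 0) =
        (40 * d + 300) * ∑ p, (if τ ≤ S.hi p - S.lo p then ((r p).length + 1) ^ 2 else 0) := by
      rw [Finset.mul_sum]
      exact Finset.sum_congr rfl fun p _ => (mul_ite_zero _ _ _).symm
    rw [e]
    have := Nat.mul_le_mul_left (40 * d + 300) hsum
    have e₂ : 2 * 1000 ^ (2 * d + 3) * L ^ (2 * d + 2) * (n + 1) = B * (n + 1) + n * B + B := by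
      rw [hB]
      ring
    have e₃ : n * (B + 200 + 30 * d) = n * B + 200 * n + 30 * d * n := by ring
    have e₄ : (30 * d + 100) * n = 30 * d * n + 100 * n := by ring
    have e₅ : (300 + 60 * d) * (n + 1) = 300 * n + 300 + 2 * (30 * d * n) + 60 * d := by ring
    have e₆ : 100 ≤ B := by
      have : 1 ≤ 1000 ^ (2 * d + 2) * L ^ (2 * d + 2) := Nat.mul_pos (by positivity) (by positivity)
      calc 100 ≤ 1000 * (1000 ^ (2 * d + 2) * L ^ (2 * d + 2)) := by omega
        _ = B := by rw [hB]; ring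
    omega
  obtain ⟨body, t, hf, ht, he⟩ := c
  exact ⟨_, t, ⟨body, _, hf, he _⟩, S.reportsOnce_flatMap_reported hτ r hnd hmem, ht⟩

end TemporalPoints

theorem Nat.size_add_one_le_mul_log {n : ℕ} (hn : 2 ≤ n) :
    ((n.size + 1 : ℕ) : ℝ) ≤ 5 * Real.log n := by
  have h₁ : 2 ≤ n.size := Nat.lt_size.2 (by simpa using hn)
  have h₂ : 2 ^ (n.size - 1) ≤ n := Nat.lt_size.1 (by omega)
  have h₃ : ((n.size - 1 : ℕ) : ℝ) * Real.log 2 ≤ Real.log n := by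
    rw [← Real.log_pow]
    exact Real.log_le_log (by positivity) (by exact_mod_cast h₂)
  have h₄ : ((n.size + 1 : ℕ) : ℝ) ≤ 3 * ((n.size - 1 : ℕ) : ℝ) := by
    exact_mod_cast (show n.size + 1 ≤ 3 * (n.size - 1) by omega)
  -- `3 / log 2 < 5`
  nlinarith [Real.log_two_gt_d9, Nat.cast_nonneg (α := ℝ) (n.size - 1)]

theorem theorem1 (d : ℕ) :
    ∃ (P : RealRAM.Program) (C : ℝ), ∀ (n : ℕ) (S : TemporalPoints d n) (τ : ℝ), 1 < τ →
      ∃ (output : RealRAM.Val) (t : ℕ),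
        P.Runs (S.encodeInput τ) output t ∧
        ReportsOnce output (S.durableTriangles τ) ∧
        (2 ≤ n → (t : ℝ) ≤
          C * ((n : ℝ) * Real.log (n : ℝ) ^ (2 * d + 2) + ((S.durableTriangles τ).ncard : ℝ))) := by
  refine ⟨RealRAM.trianglesProgram d,
    (4 * 1000 ^ (2 * d + 3) + 2 * (300 + 60 * d) + (40 * d + 300) * (100 * 4 ^ d)) *
      5 ^ (2 * d + 2), fun n S τ hτ => ?_⟩
  obtain ⟨output, t, hrun, hrep, ht⟩ := S.runs_trianglesProgram (zero_lt_one.trans hτ)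
    (L := n.size + 1) (by omega) ((Nat.lt_size_self n).trans (Nat.pow_lt_pow_right (by norm_num)
      (by omega)))
  refine ⟨output, t, hrun, hrep, fun hn => ?_⟩
  set K := (S.durableTriangles τ).ncard
  have hL : ((n.size + 1 : ℕ) : ℝ) ^ (2 * d + 2) ≤
      5 ^ (2 * d + 2) * Real.log n ^ (2 * d + 2) := by
    rw [← mul_pow]
    exact pow_le_pow_left₀ (Nat.cast_nonneg _) (Nat.size_add_one_le_mul_log hn) _
  have hL1 : (1 : ℝ) ≤ ((n.size + 1 : ℕ) : ℝ) ^ (2 * d + 2) :=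
    one_le_pow₀ (by exact_mod_cast Nat.le_add_left 1 _)
  have ht' : (t : ℝ) ≤ 2 * 1000 ^ (2 * d + 3) * ((n.size + 1 : ℕ) : ℝ) ^ (2 * d + 2) * (n + 1) +
      (300 + 60 * d) * (n + 1) + (40 * d + 300) * (100 * 4 ^ d * (n + K)) := by
    exact_mod_cast ht
  have h5 : (1 : ℝ) ≤ 5 ^ (2 * d + 2) := one_le_pow₀ (by norm_num)
  have hn1 : (n : ℝ) + 1 ≤ 2 * n := by
    have : (2 : ℝ) ≤ n := by exact_mod_cast hn
    linarith
  generalize ((n.size + 1 : ℕ) : ℝ) ^ (2 * d + 2) = X at hL hL1 ht'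
  generalize Real.log n ^ (2 * d + 2) = Y at hL ⊢
  generalize (5 : ℝ) ^ (2 * d + 2) = F at hL h5 ⊢
  have hA : (0 : ℝ) ≤ 1000 ^ (2 * d + 3) := by positivity
  generalize (1000 : ℝ) ^ (2 * d + 3) = A at hA ht' ⊢
  have hG : (0 : ℝ) ≤ 300 + 60 * d := by positivity
  have hH : (0 : ℝ) ≤ (40 * d + 300) * (100 * 4 ^ d) := by positivity
  rw [← mul_assoc (40 * (d : ℝ) + 300)] at ht'
  generalize (300 : ℝ) + 60 * d = G at hG ht' ⊢
  generalize (40 * (d : ℝ) + 300) * (100 * 4 ^ d) = H at hH ht' ⊢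
  have hn0 : (0 : ℝ) ≤ n := Nat.cast_nonneg n
  have hK0 : (0 : ℝ) ≤ K := Nat.cast_nonneg K
  have hnX : (n : ℝ) ≤ n * (F * Y) := le_mul_of_one_le_right hn0 (hL1.trans hL)
  calc (t : ℝ) ≤ 2 * A * X * (n + 1) + G * (n + 1) + H * (n + K) := ht'
    _ ≤ 2 * A * (F * Y) * (2 * n) + G * (2 * (n * (F * Y))) + H * (n * (F * Y) + F * K) := by
        gcongr
        · exact mul_nonneg (by positivity) (zero_le_one.trans (hL1.trans hL))
        · linarith
        · exact le_mul_of_one_le_left hK0 h5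
    _ = (4 * A + 2 * G + H) * (F * (n * Y)) + H * (F * K) := by ring
    _ ≤ (4 * A + 2 * G + H) * (F * (n * Y)) + (4 * A + 2 * G + H) * (F * K) := by
        gcongr
        linarith
    _ = (4 * A + 2 * G + H) * F * (n * Y + K) := by ring
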